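/- Let $(M^n,g)$, $n\ge 1$, be a connected smooth Riemannian manifold with (possibly empty) boundary $\Sigma=\partial M$, with Levi-Civita connection $\nabla$ and inward unit normal $\nu$ along $\Sigma$, and fix a spin structure on $M$. Let $S$ be a finite-dimensional Hermitian module over the Clifford algebra $Cl_n$ (with $v^2=-|v|^2$, vectors acting by skew-Hermitian operators), and let $Q$ be a chirality operator on $S$, i.e. a self-adjoint involution anticommuting with Clifford multiplication by vectors. Let $\mathbb SM$ be the bundle associated to the spin structure and $S$, with Clifford multiplication $\mathfrak c$, with the connection $\nabla$ lifted from the Levi-Civita connection, and with the action of $Q$. (For $n$ even one may take $S$ to be the irreducible complex spinor module and $Q=\omega={\bf i}^{n/2}\mathfrak c(e_1)\cdots\mathfrak c(e_n)$, so that $\mathbb SM$ is the usual spinor bundle; for $n$ odd one may take two copies of the spinor module, with Clifford multiplication $\mathfrak c\oplus(-\mathfrak c)$ and with $Q$ interchanging the copies.) Let $s\in\mathbb R$, let $\lambda_s=s/\sqrt{1+s^2}$, and let $\theta\in(-\pi/2,\pi/2)$ be such that $\tau:=\sin\theta=\lambda_s$. Along $\Sigma$ set $Q_\theta=e^{{\bf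 i}\theta Q}Q\,\mathfrak c(\nu)$. Let $\varepsilon\in\{1,-1\}$, and suppose that there is a smooth section $\Psi$ of $\mathbb SM$, not identically zero, such that $$\nabla_X\Psi+\varepsilon\,\frac{\bf i}{2}\,\mathfrak c(X)\Psi=0\quad\text{for all } X\in TM,\qquad Q_\theta\Psi=\varepsilon\Psi\quad\text{along }\Sigma,$$ that is, a nonzero imaginary Killing spinor satisfying the $\theta$-boundary condition with the same sign $\varepsilon$. Then $g$ is Einstein with $\mathrm{Ric}_g=-(n-1)g$, and $\Sigma$ is totally umbilical: $-\nabla_X\nu=\tau X$ for all $X\in T\Sigma$. In particular its mean curvature (the trace of the shape operator $X\mapsto-\nabla_X\nu$) is $H_g=(n-1)\lambda_s$. -/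

import Mathlib

open Bundle Set
open scoped Manifold ContDiff

noncomputable section

namespace KillingSpinor

/-! ## Clifford algebra, Clifford modules, chirality operators -/

/-- The quadratic form `v ↦ -|v|²` on `ℝⁿ`, so that `v * v = -|v|²` in its Clifford algebra. -/
def negForm (n : ℕ) : QuadraticForm ℝ (EuclideanSpace ℝ (Fin n)) :=
  -LinearMap.BilinMap.toQuadraticMap (innerₗ (EuclideanSpace ℝ (Fin n)))

/-- The real Clifford algebra `Cl_n`, in which `v * v = -|v|²`. -/
abbrev Cl (n : ℕ) : Type := CliffordAlgebra (negForm n)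

/-- The inclusion `ℝⁿ → Cl_n`. -/
abbrev vec (n : ℕ) : EuclideanSpace ℝ (Fin n) →ₗ[ℝ] Cl n := CliffordAlgebra.ι (negForm n)

/-- `Spin(n) ⊆ Cl_n`. -/
abbrev Spin (n : ℕ) : Submonoid (Cl n) := spinGroup (negForm n)

/-- A Hermitian Clifford module: a finite-dimensional complex Hermitian vector space `S` with an
action of `Cl_n` for which vectors act by skew-Hermitian operators (equivalently, unit vectors act
unitarily). -/
structure CliffordModule (n : ℕ) (S : Type*) [NormedAddCommGroup S] [InnerProductSpace ℂ S]
    [FiniteDimensional ℂ S] where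
  /-- The action of the Clifford algebra. -/
  act : Cl n →ₐ[ℝ] (S →L[ℂ] S)
  skew : ∀ (v : EuclideanSpace ℝ (Fin n)) (φ ψ : S),
    inner ℂ (act (vec n v) φ) ψ = -inner ℂ φ (act (vec n v) ψ)

namespace CliffordModule

variable {n : ℕ} {S : Type*} [NormedAddCommGroup S] [InnerProductSpace ℂ S]
  [FiniteDimensional ℂ S]

/-- Clifford multiplication by the vector `v ∈ ℝⁿ`. -/
def c (C : CliffordModule n S) (v : EuclideanSpace ℝ (Fin n)) : S →L[ℂ] S := C.act (vec n v)

/-- A chirality operator: a self-adjoint involution which anticommutes with Clifford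
multiplication by vectors. (It commutes with `Spin(n) ⊆ Cl_n`, hence acts on every associated
spinor bundle, and there it is parallel for the spin connection, whose connection form has values
in the even part of `Cl_n`.) -/
structure IsChirality (C : CliffordModule n S) (Q : S →L[ℂ] S) : Prop where
  selfAdjoint : ∀ φ ψ : S, inner ℂ (Q φ) ψ = inner ℂ φ (Q ψ)
  involution : Q * Q = 1
  anticomm : ∀ v : EuclideanSpace ℝ (Fin n), Q * C.c v = -(C.c v * Q)

/-- Clifford multiplication by the complex volume element `i^{n/2} e₁ ⋯ e_n` (for `n` even). -/
def complexVolume (C : CliffordModule n S) : S →L[ℂ] S :=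
  (Complex.I ^ (n / 2)) • (List.ofFn fun i : Fin n => C.c (EuclideanSpace.single i 1)).prod

lemma c_sq (C : CliffordModule n S) (v : EuclideanSpace ℝ (Fin n)) :
    C.c v * C.c v = (-inner ℝ v v : ℝ) • (1 : S →L[ℂ] S) := by
  rw [c, ← map_mul, CliffordAlgebra.ι_sq_scalar, AlgHom.commutes, Algebra.algebraMap_eq_smul_one]
  rfl

lemma c_anticomm (C : CliffordModule n S) (v w : EuclideanSpace ℝ (Fin n))
    (h : inner ℝ v w = 0) : C.c v * C.c w = -(C.c w * C.c v) := by
  have h1 := C.c_sq (v + w)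
  have hw : inner ℝ w v = 0 := by rw [real_inner_comm, h]
  have h2 : C.c (v + w) = C.c v + C.c w := by simp [c]
  rw [h2, add_mul, mul_add, mul_add, C.c_sq, C.c_sq, inner_add_add_self, h, hw] at h1
  rw [eq_neg_iff_add_eq_zero]
  have h3 : (-(inner ℝ v v + 0 + 0 + inner ℝ w w) : ℝ) • (1 : S →L[ℂ] S) =
    (-inner ℝ v v : ℝ) • (1 : S →L[ℂ] S) + (-inner ℝ w w : ℝ) • (1 : S →L[ℂ] S) := by module
  rw [h3] at h1
  have h4 : C.c v * C.c w + C.c w * C.c v =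
    ((-inner ℝ v v : ℝ) • (1 : S →L[ℂ] S) + C.c v * C.c w +
      (C.c w * C.c v + (-inner ℝ w w : ℝ) • (1 : S →L[ℂ] S))) -
    ((-inner ℝ v v : ℝ) • (1 : S →L[ℂ] S) + (-inner ℝ w w : ℝ) • (1 : S →L[ℂ] S)) := by abel
  rw [h4, h1, sub_self]

/-- Clifford multiplication by the standard basis vectors. -/
def γ (C : CliffordModule n S) (i : Fin n) : S →L[ℂ] S := C.c (EuclideanSpace.single i 1)

lemma γ_sq (C : CliffordModule n S) (i : Fin n) : C.γ i * C.γ i = -1 := by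
  rw [γ, c_sq]; simp

lemma γ_anticomm (C : CliffordModule n S) {i j : Fin n} (h : i ≠ j) :
    C.γ i * C.γ j = -(C.γ j * C.γ i) := by
  apply c_anticomm; simp [EuclideanSpace.inner_single_left, h]

lemma γ_mul_prod (C : CliffordModule n S) (j : Fin n) (l : List (Fin n)) :
    C.γ j * (l.map C.γ).prod = (-1) ^ (l.countP (· ≠ j)) * ((l.map C.γ).prod * C.γ j) := by
  induction l with
  | nil => simp
  | cons a l ih =>
    by_cases h : a = j
    · subst h
      have : (a :: l).countP (· ≠ a) = l.countP (· ≠ a) := by simp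
      rw [this, List.map_cons, List.prod_cons, mul_assoc, ← mul_assoc _ _ (_ * _),
        (Commute.neg_one_left (C.γ a)).pow_left _ |>.eq, mul_assoc, ← ih]
    · have : (a :: l).countP (· ≠ j) = l.countP (· ≠ j) + 1 := by simp [h]
      rw [this, List.map_cons, List.prod_cons, ← mul_assoc, C.γ_anticomm (Ne.symm h), pow_succ',
        neg_mul, mul_assoc, ih, mul_assoc (C.γ a), neg_one_mul, neg_mul, ← mul_assoc (C.γ a),
        ← ((Commute.neg_one_left (C.γ a)).pow_left _).eq, mul_assoc]

lemma prod_reverse (C : CliffordModule n S) (l : List (Fin n)) (hl : l.Nodup) :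
    (l.reverse.map C.γ).prod =
      (-1) ^ (∑ k ∈ Finset.range l.length, k) * (l.map C.γ).prod := by
  induction l with
  | nil => simp
  | cons a l ih =>
    have ha := (List.nodup_cons.1 hl).1
    have h1 := C.γ_mul_prod a l
    have h2 : l.countP (· ≠ a) = l.length := by
      rw [List.countP_eq_length]
      intro b hb
      simp only [ne_eq, decide_eq_true_eq]
      rintro rfl
      exact ha hb
    rw [List.reverse_cons, List.map_append, List.prod_append, ih (List.nodup_cons.1 hl).2,
      List.map_cons, List.map_nil, List.prod_singleton, List.map_cons, List.prod_cons, h1, h2,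
      List.length_cons, Finset.sum_range_succ, pow_add, mul_assoc, mul_assoc,
      ← mul_assoc ((-1) ^ l.length) ((-1) ^ l.length), ← pow_add, Even.neg_one_pow ⟨_, rfl⟩,
      one_mul]

lemma prod_mul_reverse (C : CliffordModule n S) (l : List (Fin n)) :
    (l.map C.γ).prod * (l.reverse.map C.γ).prod = (-1) ^ l.length := by
  induction l with
  | nil => simp
  | cons a l ih =>
    rw [List.reverse_cons, List.map_append, List.prod_append, List.map_cons, List.prod_cons,
      List.map_cons, List.map_nil, List.prod_singleton, mul_assoc, ← mul_assoc _ _ (C.γ a), ih,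
      ((Commute.neg_one_left (C.γ a)).pow_left _).eq, ← mul_assoc, C.γ_sq, List.length_cons,
      pow_succ']

lemma inner_prod (C : CliffordModule n S) (l : List (Fin n)) (φ ψ : S) :
    inner ℂ ((l.map C.γ).prod φ) ψ =
      (-1) ^ l.length * inner ℂ φ ((l.reverse.map C.γ).prod ψ) := by
  induction l generalizing φ ψ with
  | nil => simp
  | cons a l ih =>
    rw [List.map_cons, List.prod_cons, List.reverse_cons, List.map_append, List.prod_append,
      List.length_cons, pow_succ]
    have := C.skew (EuclideanSpace.single a 1) ((l.map C.γ).prod φ) ψ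
    rw [mul_apply_eq_comp, mul_apply_eq_comp]
    refine this.trans ?_
    rw [ih]
    simp [γ, c]

/-- For `n` even, Clifford multiplication by the complex volume element is a chirality operator. -/
theorem isChirality_complexVolume (C : CliffordModule n S) (hn : Even n) :
    C.IsChirality C.complexVolume := by
  obtain ⟨m, rfl⟩ := hn
  have hm : (m + m) / 2 = m := by omega
  have hP : C.complexVolume =
      (Complex.I ^ m) • ((List.finRange (m + m)).map C.γ).prod := by
    rw [complexVolume, hm, List.ofFn_eq_map]; rfl
  set l := List.finRange (m + m) with hl
  have hlen : l.length = m + m := by simp [hl]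
  have hnd : l.Nodup := List.nodup_finRange _
  have hsum : (-1 : S →L[ℂ] S) ^ (∑ k ∈ Finset.range l.length, k) = (-1) ^ m := by
    have h2 := Finset.sum_range_id_mul_two (m + m)
    rw [hlen]
    obtain _ | k := m
    · simp
    · have : ∑ i ∈ Finset.range (k + 1 + (k + 1)), i = (k + 1) + 2 * (k * (k + 1)) := by
        have h3 : k + 1 + (k + 1) - 1 = 2 * k + 1 := by omega
        rw [h3] at h2
        nlinarith
      rw [this, pow_add, pow_mul]
      simp
  have hrev := C.prod_reverse l hnd
  rw [hsum] at hrev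
  have hII : Complex.I ^ m * Complex.I ^ m = (-1) ^ m := by
    rw [← mul_pow, Complex.I_mul_I]
  have hs : ((-1 : S →L[ℂ] S) ^ m) = ((-1 : ℂ) ^ m) • (1 : S →L[ℂ] S) := by
    rw [← one_pow (M := S →L[ℂ] S) m, ← smul_pow]; simp
  rw [hs, smul_mul_assoc, one_mul] at hrev
  have hone : ((-1 : ℂ) ^ m) * (-1) ^ m = 1 := by rw [← mul_pow]; simp
  refine ⟨fun φ ψ => ?_, ?_, fun v => ?_⟩
  · rw [hP]
    simp only [smul_apply, inner_smul_left, inner_smul_right]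
    rw [C.inner_prod, hrev, hlen]
    simp only [smul_apply, inner_smul_right, map_pow, Complex.conj_I]
    rw [pow_add, hone, one_mul, ← mul_assoc, ← mul_pow]
    simp
  · have h := C.prod_mul_reverse l
    rw [hrev, hlen, mul_smul_comm, Even.neg_one_pow ⟨_, rfl⟩] at h
    rw [hP, smul_mul_assoc, mul_smul_comm, smul_smul, hII, h]
  · have hγ : ∀ j, C.γ j * C.complexVolume = -(C.complexVolume * C.γ j) := by
      intro j
      have hc : l.countP (· ≠ j) = m + m - 1 := by
        have h1 := List.length_eq_countP_add_countP (fun k => decide (k = j)) (l := l)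
        have h2 : l.countP (fun k => decide (k = j)) = 1 := by
          have := List.count_eq_one_of_mem hnd (List.mem_finRange j)
          simpa [List.count, BEq.beq] using this
        rw [hlen, h2] at h1
        have h3 : l.countP (· ≠ j) = l.countP (fun a => decide ¬decide (a = j) = true) := by
          congr 1; ext; simp
        omega
      have hodd : Odd (m + m - 1) := by
        have := j.2
        exact ⟨m - 1, by omega⟩
      rw [hP, mul_smul_comm, C.γ_mul_prod, hc, hodd.neg_one_pow]
      simp
    have hv : C.c v = ∑ j, (v j) • C.γ j := by
      have h1 : v = ∑ j, (v j) • EuclideanSpace.single j (1 : ℝ) := by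
        ext i; simp [Pi.single_apply]
      conv_lhs => rw [h1]
      simp [c, γ]
    rw [hv, Finset.mul_sum, Finset.sum_mul, ← Finset.sum_neg_distrib]
    refine Finset.sum_congr rfl fun j _ => ?_
    rw [mul_smul_comm, smul_mul_assoc, hγ j]
    simp

end CliffordModule

/-! ## Riemannian manifolds with boundary

`M` is modelled on the half-space `{x ∈ ℝⁿ | 0 ≤ x 0}`. -/

section Riemannian

variable {n : ℕ} [NeZero n] {M : Type*} [TopologicalSpace M]
  [ChartedSpace (EuclideanHalfSpace n) M]

/-- The tangent space `T_xM`. -/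
abbrev T (n : ℕ) [NeZero n] {M : Type*} [TopologicalSpace M]
    [ChartedSpace (EuclideanHalfSpace n) M] (x : M) : Type :=
  TangentSpace (𝓡∂ n) x

variable [RiemannianBundle (fun x : M => TangentSpace (𝓡∂ n) x)]

/-- Connections on `TM`; `D Y x v` is `(∇_v Y)(x)`. -/
abbrev Connection (n : ℕ) [NeZero n] (M : Type*) [TopologicalSpace M]
    [ChartedSpace (EuclideanHalfSpace n) M] [IsManifold (𝓡∂ n) ∞ M] :=
  CovariantDerivative (𝓡∂ n) (EuclideanSpace ℝ (Fin n)) (fun x : M => TangentSpace (𝓡∂ n) x)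

/-- A smooth Riemannian metric is of class `C¹`. -/
instance isC1Metric [IsManifold (𝓡∂ n) ∞ M]
    [h : IsContMDiffRiemannianBundle (𝓡∂ n) ∞ (EuclideanSpace ℝ (Fin n))
      (fun x : M => TangentSpace (𝓡∂ n) x)] :
    IsContMDiffRiemannianBundle (𝓡∂ n) 1 (EuclideanSpace ℝ (Fin n))
      (fun x : M => TangentSpace (𝓡∂ n) x) :=
  IsContMDiffRiemannianBundle.of_le (n := ∞) (by simp)

/-- `D` is the Levi-Civita connection of the Riemannian metric of `M`: it is smooth, torsion-free
and compatible with the metric. -/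
structure IsLeviCivita [IsManifold (𝓡∂ n) ∞ M]
    [IsContMDiffRiemannianBundle (𝓡∂ n) ∞ (EuclideanSpace ℝ (Fin n))
      (fun x : M => TangentSpace (𝓡∂ n) x)]
    (D : Connection n M) : Prop where
  smooth : CovariantDerivative.ContMDiffCovariantDerivative D ∞
  torsion_eq_zero : CovariantDerivative.torsion D = 0
  metric : CovariantDerivative.IsMetricCompatible D

instance (x : M) : FiniteDimensional ℝ (T n x) :=
  inferInstanceAs (FiniteDimensional ℝ (EuclideanSpace ℝ (Fin n)))

instance (x : M) : CompleteSpace (T n x) := FiniteDimensional.complete ℝ _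

/-- The curvature `R(X,Y)Z = ∇_X ∇_Y Z - ∇_Y ∇_X Z - ∇_{[X,Y]} Z` on vector fields. -/
def curvatureField [IsManifold (𝓡∂ n) ∞ M] (D : Connection n M) (X Y Z : Π x : M, T n x)
    (x : M) : T n x :=
  D (fun y => D Z y (Y y)) x (X x) - D (fun y => D Z y (X y)) x (Y x)
    - D Z x (VectorField.mlieBracket (𝓡∂ n) X Y x)

/-- The curvature tensor on tangent vectors at `x`, computed on the local extensions of the vectors
that are constant in the preferred trivialization at `x`. -/
def curvature [IsManifold (𝓡∂ n) ∞ M] (D : Connection n M) (x : M) (u v w : T n x) : T n x :=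
  curvatureField D (FiberBundle.extend (EuclideanSpace ℝ (Fin n)) u)
    (FiberBundle.extend (EuclideanSpace ℝ (Fin n)) v)
    (FiberBundle.extend (EuclideanSpace ℝ (Fin n)) w) x

/-- The Ricci tensor `Ric(v,w) = ∑ᵢ ⟨R(bᵢ,v)w, bᵢ⟩`, with `b` an orthonormal basis of `T_xM`. -/
def ricci [IsManifold (𝓡∂ n) ∞ M] (D : Connection n M) (x : M) (v w : T n x) : ℝ :=
  ∑ i, inner ℝ (curvature D x (stdOrthonormalBasis ℝ (T n x) i) v w)
    (stdOrthonormalBasis ℝ (T n x) i)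

/-! ### The boundary `Σ = ∂M` -/

/-- The boundary defining function of the preferred chart at `p`: the coordinate `x 0`. On the
domain of the chart it is nonnegative, with zero set `Σ`. -/
def bdFun (p q : M) : ℝ := (extChartAt (𝓡∂ n) p q) 0

/-- The differential at `q` of the boundary defining function of the chart at `p`. -/
def dBdFun (p q : M) : T n q →L[ℝ] ℝ := mvfderiv (𝓡∂ n) (bdFun (n := n) p) q

/-- The tangent space `T_pΣ ⊆ T_pM` at a point `p` of the boundary. -/
def bdTangent (p : M) : Submodule ℝ (T n p) := LinearMap.ker (dBdFun p p).toLinearMap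

/-- The normalized gradient of the boundary defining function of the chart at `p`: a smooth unit
vector field near `p`, equal to the inward unit normal at the points of `Σ`. -/
def normalField (p q : M) : T n q :=
  letI grad : T n q := (InnerProductSpace.toDual ℝ (T n q)).symm (dBdFun p q)
  ‖grad‖⁻¹ • grad

/-- The inward unit normal `ν` of `Σ` at a boundary point `p`. -/
def inwardNormal (p : M) : T n p := normalField p p

/-- The shape operator `X ↦ -∇_X ν` of `Σ` at `p` (used for `X ∈ T_pΣ`, where it does not depend on
the extension of `ν`). -/
def shapeOperator [IsManifold (𝓡∂ n) ∞ M] (D : Connection n M) (p : M) (X : T n p) : T n p :=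
  -D (normalField p) p X

/-- The mean curvature of `Σ` at `p`: the trace of the shape operator over `T_pΣ`. -/
def meanCurvature [IsManifold (𝓡∂ n) ∞ M] (D : Connection n M) (p : M) : ℝ :=
  ∑ i, inner ℝ (shapeOperator D p (stdOrthonormalBasis ℝ (bdTangent (n := n) p) i : T n p))
    (stdOrthonormalBasis ℝ (bdTangent (n := n) p) i : T n p)

/-! ## Spin structures and spinor fields -/

/-- A spin structure on the Riemannian manifold `M`, given by an open cover `U a`, smooth
orthonormal frames `e a` over `U a`, and a continuous `Spin(n)`-valued cocycle lifting the
transition functions of these frames through the covering `Spin(n) → SO(n)`, `h ↦ (v ↦ h v h⁻¹)`.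
(In particular the frames define an orientation of `M`.) -/
structure SpinStructure (ι : Type*) (n : ℕ) [NeZero n] (M : Type*) [TopologicalSpace M]
    [ChartedSpace (EuclideanHalfSpace n) M] [IsManifold (𝓡∂ n) ∞ M]
    [RiemannianBundle (fun x : M => TangentSpace (𝓡∂ n) x)] where
  /-- The members of the cover. -/
  U : ι → Set M
  isOpen_U : ∀ a, IsOpen (U a)
  cover : ∀ x, ∃ a, x ∈ U a
  /-- The local orthonormal frames. -/
  e : ι → Fin n → Π x : M, T n x
  smooth_e : ∀ a i, ContMDiffOn (𝓡∂ n) ((𝓡∂ n).prod 𝓘(ℝ, EuclideanSpace ℝ (Fin n))) ∞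
    (fun x => TotalSpace.mk' (EuclideanSpace ℝ (Fin n)) (E := fun x : M => T n x) x (e a i x)) (U a)
  orthonormal : ∀ a, ∀ x ∈ U a, Orthonormal ℝ (fun i => e a i x)
  /-- The lifted transition functions. -/
  lift : ι → ι → M → Cl n
  lift_mem : ∀ a b, ∀ x ∈ U a ∩ U b, lift a b x ∈ Spin n
  /-- Continuity for the canonical topology of the finite-dimensional real vector space `Cl_n`. -/
  continuous_lift : ∀ a b (L : Cl n →ₗ[ℝ] ℝ), ContinuousOn (fun x => L (lift a b x)) (U a ∩ U b)
  cocycle : ∀ a b d, ∀ x ∈ U a ∩ U b ∩ U d, lift a b x * lift b d x = lift a d x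
  /-- Conjugation by `lift a b x` takes the coordinates of a tangent vector in the frame `e b` to
  its coordinates in the frame `e a`. -/
  lift_frame : ∀ a b, ∀ x ∈ U a ∩ U b, ∀ v : T n x,
    lift a b x * vec n (WithLp.toLp 2 fun i => inner ℝ (e b i x) v) =
      vec n (WithLp.toLp 2 fun i => inner ℝ (e a i x) v) * lift a b x

variable [IsManifold (𝓡∂ n) ∞ M] {ι : Type*}
  {S : Type*} [NormedAddCommGroup S] [InnerProductSpace ℂ S] [FiniteDimensional ℂ S]

/-- The coordinates of a tangent vector in the frame `e a`. -/
def SpinStructure.coords (P : SpinStructure ι n M) (a : ι) (x : M) (v : T n x) :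
    EuclideanSpace ℝ (Fin n) :=
  WithLp.toLp 2 fun i => inner ℝ (P.e a i x) v

/-- A smooth section of the spinor bundle associated to the spin structure `P` and the Clifford
module `C`: a family of smooth functions `ψ a : U a → S` with `ψ a = lift a b · ψ b` on the
overlaps. -/
structure SpinorField (P : SpinStructure ι n M) (C : CliffordModule n S) where
  /-- The expression of the spinor field over `U a`. -/
  toFun : ι → M → S
  smooth : ∀ a, ContMDiffOn (𝓡∂ n) 𝓘(ℝ, S) ∞ (toFun a) (P.U a)
  compat : ∀ a b, ∀ x ∈ P.U a ∩ P.U b, toFun a x = C.act (P.lift a b x) (toFun b x)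

namespace SpinorField

variable {P : SpinStructure ι n M} {C : CliffordModule n S}

/-- The spin connection: over `U a`, `∇_v ψ = dψ(v) + (1/4) ∑_{i,j} ⟨∇_v e_i, e_j⟩ e_i · e_j · ψ`,
the lift of the Levi-Civita connection `D`. -/
def nabla (Ψ : SpinorField P C) (D : Connection n M) (a : ι) (x : M) (v : T n x) : S :=
  mvfderiv (𝓡∂ n) (Ψ.toFun a) x v +
    (1 / 4 : ℝ) • ∑ i, ∑ j, (inner ℝ (D (P.e a i) x v) (P.e a j x) : ℝ) •
      C.c (EuclideanSpace.single i 1) (C.c (EuclideanSpace.single j 1) (Ψ.toFun a x))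

/-- `Ψ` is an imaginary Killing spinor, i.e. `∇_X Ψ + ε (i/2) X · Ψ = 0`, where `ε = ±1`. -/
def IsImaginaryKilling (Ψ : SpinorField P C) (D : Connection n M) (ε : ℝ) : Prop :=
  ∀ a, ∀ x ∈ P.U a, ∀ v : T n x,
    Ψ.nabla D a x v + ((ε : ℂ) * (Complex.I / 2)) • C.c (P.coords a x v) (Ψ.toFun a x) = 0

/-- `Ψ` satisfies the `θ`-boundary condition `Q_θ Ψ = ε Ψ` along `Σ`, where `ε = ±1` and
`Q_θ = exp(iθQ) Q c(ν)` with `ν` the inward unit normal. -/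
def ThetaBoundary (Ψ : SpinorField P C) (Q : S →L[ℂ] S) (θ ε : ℝ) : Prop :=
  ∀ a, ∀ p ∈ P.U a, p ∈ (𝓡∂ n).boundary M →
    (NormedSpace.exp ((Complex.I * (θ : ℂ)) • Q) * Q * C.c (P.coords a p (inwardNormal p)))
      (Ψ.toFun a p) = (ε : ℂ) • Ψ.toFun a p

end SpinorField

end Riemannian
end KillingSpinor
end
open KillingSpinor

/-! Write the Killing equation in a local frame as the linear system `dΨ = AΨ` with `A(X) = -Γ(X) -
μ c(X)`, where `Γ` is the spin connection form and `μ = ε i/2`. Everything follows from this system,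
the parallelism of Clifford multiplication, and the injectivity of `c(v)` for `v ≠ 0` (because
`c(v)² = -|v|²`).

No zeros: by Grönwall along segments in a chart, `Ψ` vanishes near each of its zeros. The zero set
is thus open and closed, and connectedness gives `toFun_ne_zero`.

Einstein: symmetry of second derivatives of `Ψ` on coordinate fields and vanishing torsion give,
since `μ² = -1/4`, `R^S(u,v)Ψ = (1/4)[c(u), c(v)]Ψ` (`spinCurvature_apply`). Put `u = e_i`, multiply
on the left by `c(e_i)` and sum. The first Bianchi identity turns the left side into Clifford
multiplication by half the Ricci vector of `v` (`sum_cyclic`), and the right side is `-((n-1)/2)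
c(v)Ψ` (`sum_mul_comm`). Injectivity of Clifford multiplication on `Ψ ≠ 0` removes the spinor. The
same injectivity identifies the Riemann tensor with the curvature forms of the frame
(`coords_curvature`), after `c(W)` has been differentiated twice.

Umbilical: with `E = exp(iθQ)`, differentiate `E Q c(ν)Ψ = εΨ` along `X` tangent to `Σ`. The `Γ`
terms cancel, since `Q` commutes with bivectors. Both `E` and `c(ν)` pass `c(X)` at the cost of `E ↦
E⁻¹` and a sign. As the sign `ε` is the same in the Killing equation and in the boundary condition,
`ε² = 1` and `E - E⁻¹ = 2i sin θ Q` leave `c(∇_X ν + sin θ X)Ψ = 0` (`shape_of_boundary_condition`).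
Injectivity gives `-∇_X ν = sin θ X`, and the trace gives the mean curvature. -/

noncomputable section
namespace KillingSpinor

/-! ### Differential calculus in charts, up to the boundary -/

section Calculus

open Filter Topology

variable {E : Type*} [NormedAddCommGroup E] [NormedSpace ℝ E]
  {H : Type*} [TopologicalSpace H] {I : ModelWithCorners ℝ E H}
  {M : Type*} [TopologicalSpace M] [ChartedSpace H M]
  {V W Z : Type*} [NormedAddCommGroup V] [NormedSpace ℝ V] [NormedAddCommGroup W]
  [NormedSpace ℝ W] [NormedAddCommGroup Z] [NormedSpace ℝ Z]

lemma hasFDerivWithinAt_mvfderiv {f : M → V} {x : M} (hf : MDifferentiableAt I 𝓘(ℝ, V) f x) :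
    HasFDerivWithinAt (f ∘ (extChartAt I x).symm) (mvfderiv I f x : E →L[ℝ] V) (range I)
      (extChartAt I x x) :=
  hf.hasMFDerivAt.2

/-- Derivatives within `range I` are unique at boundary points as well, because the range of a model
with corners has unique differentials. -/
lemma mvfderiv_eq_of_hasFDerivWithinAt {f : M → V} {x : M} {f' : E →L[ℝ] V}
    (hf : MDifferentiableAt I 𝓘(ℝ, V) f x)
    (h : HasFDerivWithinAt (f ∘ (extChartAt I x).symm) f' (range I) (extChartAt I x x))
    (v : TangentSpace I x) : mvfderiv I f x v = f' v :=
  congr($((I.uniqueDiffOn _ (mem_range_self _)).eq (hasFDerivWithinAt_mvfderiv hf) h) v)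

lemma mdifferentiableAt_clm_apply₂ (B : V →L[ℝ] W →L[ℝ] Z) {f : M → V} {g : M → W} {x : M}
    (hf : MDifferentiableAt I 𝓘(ℝ, V) f x) (hg : MDifferentiableAt I 𝓘(ℝ, W) g x) :
    MDifferentiableAt I 𝓘(ℝ, Z) (fun y => B (f y) (g y)) x := by
  have h1 : MDifferentiableAt I 𝓘(ℝ, W →L[ℝ] Z) (fun y => B (f y)) x :=
    B.differentiableAt.mdifferentiableAt.comp x hf
  exact h1.clm_apply hg

lemma mvfderiv_clm_apply₂ (B : V →L[ℝ] W →L[ℝ] Z) {f : M → V} {g : M → W} {x : M}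
    (hf : MDifferentiableAt I 𝓘(ℝ, V) f x) (hg : MDifferentiableAt I 𝓘(ℝ, W) g x)
    (v : TangentSpace I x) :
    mvfderiv I (fun y => B (f y) (g y)) x v =
      B (mvfderiv I f x v) (g x) + B (f x) (mvfderiv I g x v) := by
  have h := B.hasFDerivWithinAt_of_bilinear (hasFDerivWithinAt_mvfderiv hf)
    (hasFDerivWithinAt_mvfderiv hg)
  refine (mvfderiv_eq_of_hasFDerivWithinAt (mdifferentiableAt_clm_apply₂ B hf hg) h v).trans ?_
  have hx := (extChartAt I x).left_inv (mem_extChartAt_source (I := I) x)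
  rw [Function.comp_apply, Function.comp_apply, hx]
  change B (f x) (mvfderiv I g x v) + B (mvfderiv I f x v) (g x) = _
  rw [add_comm]

lemma mdifferentiableAt_clm (L : V →L[ℝ] W) {f : M → V} {x : M}
    (hf : MDifferentiableAt I 𝓘(ℝ, V) f x) : MDifferentiableAt I 𝓘(ℝ, W) (fun y => L (f y)) x :=
  L.differentiableAt.mdifferentiableAt.comp x hf

lemma mvfderiv_clm (L : V →L[ℝ] W) {f : M → V} {x : M}
    (hf : MDifferentiableAt I 𝓘(ℝ, V) f x) (v : TangentSpace I x) :
    mvfderiv I (fun y => L (f y)) x v = L (mvfderiv I f x v) :=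
  mvfderiv_eq_of_hasFDerivWithinAt (mdifferentiableAt_clm L hf)
    (L.hasFDerivAt.comp_hasFDerivWithinAt _ (hasFDerivWithinAt_mvfderiv hf)) v

lemma mvfderiv_congr {f g : M → V} {x : M} (h : f =ᶠ[𝓝 x] g) :
    mvfderiv I f x = mvfderiv I g x := by
  ext v
  simp only [mvfderiv, h.mfderiv_eq]
  rfl

lemma mvfderiv_finsetSum {ι : Type*} (s : Finset ι) {f : ι → M → V} {x : M}
    (hf : ∀ i ∈ s, MDifferentiableAt I 𝓘(ℝ, V) (f i) x) (v : TangentSpace I x) :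
    MDifferentiableAt I 𝓘(ℝ, V) (fun y => ∑ i ∈ s, f i y) x ∧
    mvfderiv I (fun y => ∑ i ∈ s, f i y) x v = ∑ i ∈ s, mvfderiv I (f i) x v := by
  classical
  induction s using Finset.induction_on with
  | empty => exact ⟨by simpa using mdifferentiableAt_const, by simp [mvfderiv_const]⟩
  | insert a s ha ih =>
    have ih := ih fun i hi => hf i (Finset.mem_insert_of_mem hi)
    have h1 := hf a (Finset.mem_insert_self a s)
    simp only [Finset.sum_insert ha]
    refine ⟨h1.add ih.1, ?_⟩
    rw [mvfderiv_fun_add h1 ih.1, add_apply, ih.2]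

lemma comp_symm_comp_extChartAt_eventuallyEq {V : Type*} (f : M → V) {x y : M}
    (hy : y ∈ (chartAt H x).source) :
    (f ∘ (extChartAt I x).symm) ∘ extChartAt I x =ᶠ[𝓝 y] f := by
  have hy' : y ∈ (extChartAt I x).source := by rwa [extChartAt_source]
  filter_upwards [(isOpen_extChartAt_source (I := I) x).mem_nhds hy'] with z hz
  rw [Function.comp_apply, Function.comp_apply, (extChartAt I x).left_inv hz]

lemma contDiffWithinAt_comp_symm {f : M → V} {x : M} (hf : ContMDiffAt I 𝓘(ℝ, V) ∞ f x) :
    ContDiffWithinAt ℝ ∞ (f ∘ (extChartAt I x).symm) (range I) (extChartAt I x x) :=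
  (contMDiffAt_iff.1 hf).2

variable [IsManifold I ∞ M]

lemma mdifferentiableAt_comp_extChartAt {h : E → V} {x y : M} (hy : y ∈ (chartAt H x).source)
    (hh : DifferentiableWithinAt ℝ h (range I) (extChartAt I x y)) (v : TangentSpace I y) :
    MDifferentiableAt I 𝓘(ℝ, V) (h ∘ extChartAt I x) y ∧
    mvfderiv I (h ∘ extChartAt I x) y v = fderivWithin ℝ h (range I) (extChartAt I x y)
      (mfderiv I 𝓘(ℝ, E) (extChartAt I x) y v) := by
  have hφ : MDifferentiableAt I 𝓘(ℝ, E) (extChartAt I x) y := mdifferentiableAt_extChartAt hy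
  have hcomp := HasMFDerivWithinAt.comp y hh.hasFDerivWithinAt.hasMFDerivWithinAt
    (hφ.hasMFDerivAt.hasMFDerivWithinAt (s := univ))
    (fun z _ => mem_range_self _)
  rw [hasMFDerivWithinAt_univ] at hcomp
  refine ⟨hcomp.mdifferentiableAt, ?_⟩
  simp only [mvfderiv, hcomp.mfderiv]
  rfl

/-- By definition the derivative at `y` uses the preferred chart at `y`. Here it is transferred to
the one fixed chart at `x`, so that it can be differentiated again in `y`. -/
lemma mvfderiv_eq_fderivWithin {f : M → V} {x y : M} (hy : y ∈ (chartAt H x).source)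
    (hf : MDifferentiableAt I 𝓘(ℝ, V) f y) (v : TangentSpace I y) :
    DifferentiableWithinAt ℝ (f ∘ (extChartAt I x).symm) (range I) (extChartAt I x y) ∧
    mvfderiv I f y v = fderivWithin ℝ (f ∘ (extChartAt I x).symm) (range I) (extChartAt I x y)
      (mfderiv I 𝓘(ℝ, E) (extChartAt I x) y v) := by
  have hy' : y ∈ (extChartAt I x).source := by rwa [extChartAt_source]
  have hinv : MDifferentiableWithinAt 𝓘(ℝ, E) I (extChartAt I x).symm (range I)
      (extChartAt I x y) :=
    mdifferentiableWithinAt_extChartAt_symm ((extChartAt I x).map_source hy')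
  have hF : MDifferentiableWithinAt 𝓘(ℝ, E) 𝓘(ℝ, V) (f ∘ (extChartAt I x).symm) (range I)
      (extChartAt I x y) := by
    refine MDifferentiableAt.comp_mdifferentiableWithinAt _ ?_ hinv
    rwa [(extChartAt I x).left_inv hy']
  have hF' := hF.differentiableWithinAt
  refine ⟨hF', ?_⟩
  rw [← mvfderiv_congr (comp_symm_comp_extChartAt_eventuallyEq (I := I) f hy)]
  exact (mdifferentiableAt_comp_extChartAt hy hF' v).2

/-- The coordinates of a tangent vector at `x` in the preferred chart at `x`. -/
def toModel {x : M} (v : TangentSpace I x) : E := v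

/-- The coordinate expression of a vector field in the preferred chart at `x`. -/
def coordField (I : ModelWithCorners ℝ E H) (x : M) (X : Π y : M, TangentSpace I y) (y : M) : E :=
  mfderiv I 𝓘(ℝ, E) (extChartAt I x) y (X y)

lemma coordField_eq {x y : M} (hy : y ∈ (chartAt H x).source)
    (X : Π y : M, TangentSpace I y) :
    coordField I x X y = (trivializationAt E (TangentSpace I) x ⟨y, X y⟩).2 := by
  rw [coordField, ← TangentBundle.continuousLinearMapAt_trivializationAt (I := I) hy]
  exact Bundle.Trivialization.continuousLinearMapAt_apply_of_mem (R := ℝ) _ (b := y) hy (X y)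

lemma coordField_self {x : M} (X : Π y : M, TangentSpace I y) :
    coordField I x X x = toModel (X x) := by
  rw [coordField, mfderiv_extChartAt_self]
  rfl

lemma coordField_extend {x y : M} (hy : y ∈ (chartAt H x).source)
    (v : TangentSpace I x) : coordField I x (FiberBundle.extend E v) y = toModel v := by
  rw [coordField_eq hy]
  have h1 := (coordField_eq (mem_chart_source H x) (FiberBundle.extend E v)).symm.trans
    (coordField_self _)
  rw [FiberBundle.extend_apply_self] at h1
  unfold FiberBundle.extend
  exact (congrArg Prod.snd (Bundle.Trivialization.apply_mk_symm _ (by exact hy) _)).trans h1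

lemma contMDiffAt_mvfderiv_apply {f : M → V} {X : Π y : M, TangentSpace I y}
    {x : M} (hf : ContMDiffAt I 𝓘(ℝ, V) ∞ f x)
    (hX : ContMDiffAt I (I.prod 𝓘(ℝ, E)) ∞ (T% X) x) :
    ContMDiffAt I 𝓘(ℝ, V) ∞ (fun y => mvfderiv I f y (X y)) x := by
  have hV : ContMDiffAt I 𝓘(ℝ, E) ∞ (coordField I x X) x := by
    refine ((contMDiffAt_section x).1 hX).congr_of_eventuallyEq ?_
    filter_upwards [(chartAt H x).open_source.mem_nhds (mem_chart_source H x)] with y hy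
    exact coordField_eq hy X
  have h1 : ContDiffWithinAt ℝ ∞ (fderivWithin ℝ (f ∘ (extChartAt I x).symm) (range I)) (range I)
      (extChartAt I x x) :=
    (contDiffWithinAt_comp_symm hf).fderivWithin_right I.uniqueDiffOn (by simp) (mem_range_self _)
  have h2 : ContMDiffAt I 𝓘(ℝ, E →L[ℝ] V) ∞
      (fderivWithin ℝ (f ∘ (extChartAt I x).symm) (range I) ∘ extChartAt I x) x := by
    rw [← contMDiffWithinAt_univ]
    exact ContMDiffWithinAt.comp x h1.contMDiffWithinAt
      (contMDiffAt_extChartAt (I := I) (n := ∞)).contMDiffWithinAt (fun z _ => mem_range_self _)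
  refine (h2.clm_apply hV).congr_of_eventuallyEq ?_
  filter_upwards [(chartAt H x).open_source.mem_nhds (mem_chart_source H x),
    (contMDiffAt_iff_contMDiffAt_nhds (n := 1) (by simp)).1 (hf.of_le (by simp))] with y hy hfy
  exact (mvfderiv_eq_fderivWithin hy (hfy.mdifferentiableAt one_ne_zero) (X y)).2

/-- The extensions have constant coefficients in the chart at `x`, so both sides are values of the
second derivative of the coordinate expression of `f`, with no first-order correction. This is the
source of both curvature identities below. -/
lemma mvfderiv_mvfderiv_extend_comm {f : M → V} {x : M}
    (hf : ContMDiffAt I 𝓘(ℝ, V) ∞ f x) (u v : TangentSpace I x) :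
    mvfderiv I (fun y => mvfderiv I f y (FiberBundle.extend E v y)) x u =
      mvfderiv I (fun y => mvfderiv I f y (FiberBundle.extend E u y)) x v := by
  set F := f ∘ (extChartAt I x).symm with hF
  have hFc := contDiffWithinAt_comp_symm hf
  have hd : DifferentiableWithinAt ℝ (fderivWithin ℝ F (range I)) (range I) (extChartAt I x x) :=
    (hFc.fderivWithin_right I.uniqueDiffOn (m := 1) (by
      rw [one_add_one_eq_two]; exact ENat.LEInfty.out)
      (mem_range_self _)).differentiableWithinAt one_ne_zero
  have key : ∀ u v : TangentSpace I x,
      mvfderiv I (fun y => mvfderiv I f y (FiberBundle.extend E v y)) x u =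
      fderivWithin ℝ (fderivWithin ℝ F (range I)) (range I) (extChartAt I x x) (toModel u) (toModel v) := by
    intro u v
    have hev : (fun y => mvfderiv I f y (FiberBundle.extend E v y)) =ᶠ[𝓝 x]
        (fun z => fderivWithin ℝ F (range I) z (toModel v)) ∘ extChartAt I x := by
      filter_upwards [(chartAt H x).open_source.mem_nhds (mem_chart_source H x),
        (contMDiffAt_iff_contMDiffAt_nhds (n := 1) (by simp)).1 (hf.of_le (by simp))] with y hy hfy
      refine (mvfderiv_eq_fderivWithin hy (hfy.mdifferentiableAt one_ne_zero) _).2.trans ?_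
      exact congrArg _ (coordField_extend hy v)
    have hd' : HasFDerivWithinAt (fun z => fderivWithin ℝ F (range I) z (toModel v))
        ((ContinuousLinearMap.apply ℝ V (toModel v)).comp
          (fderivWithin ℝ (fderivWithin ℝ F (range I)) (range I) (extChartAt I x x)))
        (range I) (extChartAt I x x) :=
      (ContinuousLinearMap.apply ℝ V (toModel v)).hasFDerivAt.comp_hasFDerivWithinAt _
        hd.hasFDerivWithinAt
    rw [mvfderiv_congr hev, (mdifferentiableAt_comp_extChartAt (mem_chart_source H x)
      hd'.differentiableWithinAt u).2, hd'.fderivWithin (I.uniqueDiffOn _ (mem_range_self _)),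
      mfderiv_extChartAt_self]
    rfl
  rw [key, key]
  refine ContDiffWithinAt.isSymmSndFDerivWithinAt (hFc.of_le (m := 2) ENat.LEInfty.out)
    (by simp) I.uniqueDiffOn ?_ (mem_range_self _) _ _
  -- At a boundary point, symmetry of the second derivative passes to the limit from the interior of
  -- the half-space.
  exact I.range_subset_closure_interior (mem_range_self _)

lemma contMDiffAt_extend_of_mem {x y : M} (hy : y ∈ (chartAt H x).source)
    (v : TangentSpace I x) :
    ContMDiffAt I (I.prod 𝓘(ℝ, E)) ∞ (T% (FiberBundle.extend E v)) y := by
  have := (inferInstance : ContMDiffVectorBundle ∞ E (TangentSpace I : M → Type _) I)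
  rw [(trivializationAt E (TangentSpace I) x).contMDiffAt_section_iff (by exact hy)]
  refine (contMDiffAt_const (c := (toModel v))).congr_of_eventuallyEq ?_
  filter_upwards [(chartAt H x).open_source.mem_nhds hy] with z hz
  exact (coordField_eq hz _).symm.trans (coordField_extend hz v)

/-- The constant vector field `w` on the vector space `E`. -/
def constField (w : E) : Π z : E, TangentSpace 𝓘(ℝ, E) z := fun _ => w

lemma mlieBracket_constField (u v z : E) :
    VectorField.mlieBracket 𝓘(ℝ, E) (constField u) (constField v) z = 0 := by
  rw [← VectorField.mlieBracketWithin_univ, VectorField.mlieBracketWithin_eq_lieBracketWithin]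
  have h : ∀ w : E, (fun _ : E => w) = constField w := fun _ => rfl
  simp [VectorField.lieBracketWithin, ← h]
  rfl

/-- The extensions are pullbacks of constant fields under the chart, and brackets commute with
pullback. -/
lemma mlieBracket_extend_eq_zero [CompleteSpace E] {x y : M}
    (hy : y ∈ (chartAt H x).source) (u v : TangentSpace I x) :
    VectorField.mlieBracket I (FiberBundle.extend E u) (FiberBundle.extend E v) y = 0 := by
  have hev : ∀ w : TangentSpace I x, (FiberBundle.extend E w : Π y : M, TangentSpace I y) =ᶠ[𝓝 y]
      VectorField.mpullback I 𝓘(ℝ, E) (extChartAt I x) (constField (toModel w)) := by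
    intro w
    filter_upwards [(chartAt H x).open_source.mem_nhds hy] with z hz
    have hz' : z ∈ (extChartAt I x).source := by rwa [extChartAt_source]
    exact ((isInvertible_mfderiv_extChartAt hz').inverse_apply_eq.2
      (coordField_extend hz w).symm).symm
  rw [Filter.EventuallyEq.mlieBracket_vectorField_eq (hev u) (hev v)]
  have hc : ∀ w : E, MDifferentiableAt 𝓘(ℝ, E) (𝓘(ℝ, E).prod 𝓘(ℝ, E))
      (T% (constField w)) (extChartAt I x y) := by
    intro w
    exact ((contMDiffAt_vectorSpace_iff_contDiffAt (n := 1) (V := constField w)).2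
      contDiffAt_const).mdifferentiableAt one_ne_zero
  have : IsManifold I (minSmoothness ℝ 2) M := by
    rw [minSmoothness_of_isRCLikeNormedField]; infer_instance
  have : IsManifold 𝓘(ℝ, E) (minSmoothness ℝ 2) E := by
    rw [minSmoothness_of_isRCLikeNormedField]; infer_instance
  refine (VectorField.mpullback_mlieBracket (n := 2) (hc (toModel u)) (hc (toModel v))
    (contMDiffAt_extChartAt' hy) (by simp)).symm.trans ?_
  rw [VectorField.mpullback_apply]
  exact (congrArg _ (mlieBracket_constField (toModel u) (toModel v) _)).trans (map_zero _)

/-- Smoothness of `D` concerns global sections, whereas frames are only local. A bump function makes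
`σ` global, and locality of `D` removes the bump where it equals one. -/
lemma contMDiffOn_covariantDerivative_apply [FiniteDimensional ℝ E] [T2Space M]
    {D : CovariantDerivative I E (TangentSpace I : M → Type _)}
    (hD : CovariantDerivative.ContMDiffCovariantDerivative D ∞) {s : Set M} (hs : IsOpen s)
    {σ X : Π y : M, TangentSpace I y} (hσ : ContMDiffOn I (I.prod 𝓘(ℝ, E)) ∞ (T% σ) s)
    (hX : ContMDiffOn I (I.prod 𝓘(ℝ, E)) ∞ (T% X) s) :
    ContMDiffOn I (I.prod 𝓘(ℝ, E)) ∞ (T% (fun y => D σ y (X y))) s := by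
  intro x hx
  refine ContMDiffAt.contMDiffWithinAt ?_
  obtain ⟨ρ, -, hρ⟩ := (SmoothBumpFunction.nhds_basis_tsupport (I := I) x).mem_iff.1
    (hs.mem_nhds hx)
  have hglob : ContMDiff I (I.prod 𝓘(ℝ, E)) ∞ (T% ((ρ : M → ℝ) • σ)) :=
    ContMDiffOn.smul_section_of_tsupport ρ.contMDiff.contMDiffOn hs hρ hσ
  have hDs := hD.contMDiff.contMDiff (σ := (ρ : M → ℝ) • σ) (by simpa using! hglob.contMDiffOn)
  have h1 := (hDs.contMDiffAt Filter.univ_mem).clm_bundle_apply (hX.contMDiffAt (hs.mem_nhds hx))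
  refine h1.congr_of_eventuallyEq ?_
  filter_upwards [ρ.eventuallyEq_one.eventually_nhds, hs.mem_nhds hx] with y hy hys
  have hσy := (hσ.contMDiffAt (hs.mem_nhds hys)).mdifferentiableAt (by simp)
  have : D σ y = D ((ρ : M → ℝ) • σ) y := by
    refine D.isCovariantDerivativeOnUniv.congr_of_eventuallyEq hσy
      (hglob.contMDiffAt.mdifferentiableAt (by simp)) Filter.univ_mem ?_
    filter_upwards [hy] with z hz
    simp [hz]
  simp only [this]

end Calculus
end KillingSpinor
end

noncomputable section
namespace KillingSpinor

/-! ### Algebra of the Clifford relations -/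

section CliffordRelations

variable {A : Type*} [Ring A] [Algebra ℝ A] {ι : Type*} [DecidableEq ι]

/-- The element `(1/4) ∑ rᵢⱼ γᵢ γⱼ` defined by a matrix `r` and elements `γᵢ` of an algebra. -/
def bivector [Fintype ι] (γ : ι → A) (r : ι → ι → ℝ) : A :=
  (1 / 4 : ℝ) • ∑ i, ∑ j, r i j • (γ i * γ j)

/-- The Clifford relations `γᵢ γⱼ + γⱼ γᵢ = -2 δᵢⱼ`. -/
def CliffordRelations (γ : ι → A) : Prop :=
  ∀ i j, γ i * γ j = -(γ j * γ i) + (if i = j then (-2 : ℝ) else 0) • (1 : A)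

variable {γ : ι → A}

lemma CliffordRelations.mul_mul_comm (hγ : CliffordRelations γ) (i j k : ι) :
    γ i * γ j * γ k - γ k * (γ i * γ j) =
      (if i = k then (2 : ℝ) else 0) • γ j - (if j = k then (2 : ℝ) else 0) • γ i := by
  have h1 : γ i * γ j * γ k = γ i * (-(γ k * γ j) + (if j = k then (-2 : ℝ) else 0) • (1 : A)) := by
    rw [mul_assoc, ← hγ j k]
  have h2 : γ k * (γ i * γ j) = (-(γ i * γ k) + (if i = k then (-2 : ℝ) else 0) • (1 : A)) * γ j := by
    rw [← mul_assoc, hγ k i]; simp only [eq_comm]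
  rw [h1, h2]
  split_ifs <;> (simp [mul_add, add_mul, mul_assoc]; try abel)

variable [Fintype ι]

/-- The infinitesimal covering `spin(n) → so(n)`; the factor `1/4` in `bivector` is chosen so that
no constant appears here. -/
lemma CliffordRelations.bivector_comm (hγ : CliffordRelations γ) {r : ι → ι → ℝ}
    (hr : ∀ i j, r i j = -r j i) (k : ι) :
    bivector γ r * γ k - γ k * bivector γ r = ∑ j, r k j • γ j := by
  have h1 : bivector γ r * γ k - γ k * bivector γ r =
      (1 / 4 : ℝ) • ∑ i, ∑ j, r i j • (γ i * γ j * γ k - γ k * (γ i * γ j)) := by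
    simp only [bivector, smul_mul_assoc, mul_smul_comm, Finset.sum_mul, Finset.mul_sum,
      smul_sub, Finset.sum_sub_distrib]
  rw [h1]
  have h2 : ∑ i, ∑ j, r i j • (if i = k then (2 : ℝ) else 0) • γ j = ∑ j, (2 * r k j) • γ j := by
    rw [Finset.sum_comm]
    refine Finset.sum_congr rfl fun j _ => ?_
    rw [Finset.sum_eq_single k (fun i _ hi => by simp [hi]) (by simp), smul_smul, if_pos rfl,
      mul_comm]
  have h3 : ∑ i, ∑ j, r i j • (if j = k then (2 : ℝ) else 0) • γ i =
      -∑ j, (2 * r k j) • γ j := by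
    rw [← Finset.sum_neg_distrib]
    refine Finset.sum_congr rfl fun j _ => ?_
    rw [Finset.sum_eq_single k (fun i _ hi => by simp [hi]) (by simp), smul_smul, if_pos rfl,
      mul_comm, hr j k]
    module
  simp only [hγ.mul_mul_comm, smul_sub, Finset.sum_sub_distrib, h2, h3]
  rw [← Finset.sum_neg_distrib, ← smul_sub, ← Finset.sum_sub_distrib, Finset.smul_sum]
  refine Finset.sum_congr rfl fun j _ => ?_
  module

/-- Commutation with a fixed element is a derivation, which reduces the claim to `bivector_comm`. In
this index convention `bivector` reverses matrix commutators. -/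
lemma CliffordRelations.bivector_comm_bivector (hγ : CliffordRelations γ) {α β : ι → ι → ℝ}
    (hα : ∀ i j, α i j = -α j i) :
    bivector γ α * bivector γ β - bivector γ β * bivector γ α =
      bivector γ (fun i j => ∑ k, (β i k * α k j - α i k * β k j)) := by
  have h1 : bivector γ α * bivector γ β - bivector γ β * bivector γ α =
      (1 / 4 : ℝ) • ∑ i, ∑ j, β i j •
        ((bivector γ α * γ i - γ i * bivector γ α) * γ j +
          γ i * (bivector γ α * γ j - γ j * bivector γ α)) := by
    generalize bivector γ α = a
    simp only [bivector, smul_mul_assoc, mul_smul_comm, Finset.sum_mul, Finset.mul_sum, ← smul_sub,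
      ← Finset.sum_sub_distrib]
    refine congrArg _ (Finset.sum_congr rfl fun i _ => Finset.sum_congr rfl fun j _ =>
      congrArg _ ?_)
    noncomm_ring
  rw [h1]
  simp only [hγ.bivector_comm hα]
  simp only [bivector, Finset.sum_mul, Finset.mul_sum, smul_add,
    Finset.smul_sum, Finset.sum_add_distrib, sub_smul, Finset.sum_sub_distrib, Finset.sum_smul]
  have h2 : ∑ i, ∑ j, ∑ k, (1 / 4 : ℝ) • β i j • ((α i k • γ k) * γ j) =
      -∑ i, ∑ j, ∑ k, (1 / 4 : ℝ) • (α i k * β k j) • (γ i * γ j) := by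
    simp only [← Finset.sum_neg_distrib]
    have : ∀ i : ι, ∑ j, ∑ k, (1 / 4 : ℝ) • β i j • ((α i k • γ k) * γ j) =
        ∑ k, ∑ j, (1 / 4 : ℝ) • β i j • ((α i k • γ k) * γ j) := fun i => Finset.sum_comm
    simp only [this]
    rw [Finset.sum_comm]
    refine Finset.sum_congr rfl fun i _ => ?_
    rw [Finset.sum_comm]
    refine Finset.sum_congr rfl fun j _ => Finset.sum_congr rfl fun k _ => ?_
    rw [hα k i, smul_mul_assoc]
    module
  have h3 : ∑ i, ∑ j, ∑ k, (1 / 4 : ℝ) • β i j • (γ i * (α j k • γ k)) =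
      ∑ i, ∑ j, ∑ k, (1 / 4 : ℝ) • (β i k * α k j) • (γ i * γ j) := by
    refine Finset.sum_congr rfl fun i _ => ?_
    rw [Finset.sum_comm]
    refine Finset.sum_congr rfl fun j _ => Finset.sum_congr rfl fun k _ => ?_
    rw [mul_smul_comm]
    module
  rw [h2, h3]
  simp only [smul_sub, Finset.smul_sum]
  abel

omit [Fintype ι] in
lemma CliffordRelations.cyclic_mul (hγ : CliffordRelations γ) (i k j : ι) :
    γ i * γ k * γ j = γ k * γ j * γ i - (if k = i then (2 : ℝ) else 0) • γ j
      + (if j = i then (2 : ℝ) else 0) • γ k := by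
  have := hγ.mul_mul_comm k j i
  rw [sub_eq_iff_eq_add] at this
  rw [this, mul_assoc]
  abel

/-- The contraction by which the first Bianchi identity enters the Clifford trace of the
curvature. -/
lemma CliffordRelations.sum_cyclic (hγ : CliffordRelations γ) {P : ι → ι → ι → ℝ}
    (hP : ∀ i k j, P i k j = -P i j k) (hcyc : ∀ i k j, P i k j + P k j i + P j i k = 0) :
    ∑ i, ∑ k, ∑ j, P i k j • (γ i * γ k * γ j) = (2 : ℝ) • ∑ k, ∑ i, P i k i • γ k := by
  have hkk : ∀ i k, P i k k = 0 := fun i k => by linarith [hP i k k]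
  have rot : ∀ f : ι → ι → ι → A, ∑ i, ∑ k, ∑ j, f k j i = ∑ i, ∑ k, ∑ j, f i k j := by
    intro f
    rw [Finset.sum_comm]
    exact Finset.sum_congr rfl fun i _ => Finset.sum_comm
  set s := ∑ i, ∑ k, ∑ j, P i k j • (γ i * γ k * γ j) with hs
  set ρ := ∑ k, ∑ i, P i k i • γ k with hρ
  -- Moving the first generator past the other two rotates the coefficients cyclically, and the two
  -- anticommutators leave contractions of `p`.
  have step : ∀ p : ι → ι → ι → ℝ, ∑ i, ∑ k, ∑ j, p i k j • (γ i * γ k * γ j) =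
      ∑ i, ∑ k, ∑ j, p j i k • (γ i * γ k * γ j) - (2 : ℝ) • ∑ k, ∑ i, p i i k • γ k
        + (2 : ℝ) • ∑ k, ∑ i, p i k i • γ k := by
    intro p
    have h1 := rot fun i k j => p j i k • (γ i * γ k * γ j)
    have h2 : ∑ i, ∑ k, ∑ j, p i k j • (if k = i then (2 : ℝ) else 0) • γ j =
        (2 : ℝ) • ∑ k, ∑ i, p i i k • γ k := by
      rw [Finset.sum_comm (γ := ι) (f := fun k i => p i i k • γ k), Finset.smul_sum]
      refine Finset.sum_congr rfl fun i _ => ?_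
      rw [Finset.sum_eq_single i (fun k _ hk => by simp [hk]) (by simp), Finset.smul_sum]
      refine Finset.sum_congr rfl fun j _ => ?_
      rw [if_pos rfl, smul_comm]
    have h3 : ∑ i, ∑ k, ∑ j, p i k j • (if j = i then (2 : ℝ) else 0) • γ k =
        (2 : ℝ) • ∑ k, ∑ i, p i k i • γ k := by
      rw [Finset.sum_comm, Finset.smul_sum]
      refine Finset.sum_congr rfl fun k _ => ?_
      rw [Finset.smul_sum]
      refine Finset.sum_congr rfl fun i _ => ?_
      rw [Finset.sum_eq_single i (fun k _ hk => by simp [hk]) (by simp), if_pos rfl, smul_comm]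
    rw [← h1, ← h2, ← h3]
    simp only [← Finset.sum_sub_distrib, ← Finset.sum_add_distrib, ← smul_sub, ← smul_add,
      ← hγ.cyclic_mul]
  have e1 := step P
  have e2 := step fun i k j => P j i k
  have e3 : s + ∑ i, ∑ k, ∑ j, P k j i • (γ i * γ k * γ j) +
      ∑ i, ∑ k, ∑ j, P j i k • (γ i * γ k * γ j) = 0 := by
    rw [hs]
    simp only [← Finset.sum_add_distrib, ← add_smul, hcyc, zero_smul, Finset.sum_const_zero]
  have h4 : ∑ k, ∑ i, P i i k • γ k = -ρ := by
    rw [hρ]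
    simp only [← Finset.sum_neg_distrib, ← neg_smul, ← hP]
  simp only [h4, hkk, zero_smul, Finset.sum_const_zero, smul_zero] at e1 e2
  rw [← hs, ← hρ] at e1
  -- The three rotated sums add up to zero, while the second and third equal `s - 4ρ` and `s - 2ρ`;
  -- hence `3s = 6ρ`.
  have h5 : (3 : ℝ) • s = (3 : ℝ) • ((2 : ℝ) • ρ) := by
    generalize ∑ i, ∑ k, ∑ j, P k j i • (γ i * γ k * γ j) = a at e2 e3
    generalize ∑ i, ∑ k, ∑ j, P j i k • (γ i * γ k * γ j) = b at e1 e2 e3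
    have ha : a = b + (2 : ℝ) • ρ := by rw [e2]; module
    have hb : b = s - (4 : ℝ) • ρ := by rw [e1]; module
    calc (3 : ℝ) • s = (s + a + b) + (6 : ℝ) • ρ := by rw [ha, hb]; module
      _ = _ := by rw [e3]; module
  exact smul_right_injective A (three_ne_zero (α := ℝ)) h5

/-- For a single `γ k`, the term `i = k` vanishes and each of the other `n - 1` terms is `-2 γ k`.
-/
lemma CliffordRelations.sum_mul_comm (hγ : CliffordRelations γ) (w : ι → ℝ) :
    ∑ i, γ i * (γ i * (∑ k, w k • γ k) - (∑ k, w k • γ k) * γ i) =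
      (-2 * ((Fintype.card ι : ℝ) - 1)) • ∑ k, w k • γ k := by
  have hsq : ∀ i, γ i * γ i = (-1 : ℝ) • (1 : A) := by
    intro i
    have := hγ i i
    rw [if_pos rfl] at this
    have h2 : (2 : ℝ) • (γ i * γ i) = (2 : ℝ) • ((-1 : ℝ) • (1 : A)) := by
      rw [two_smul]; nth_rw 1 [this]; rw [smul_smul]; norm_num
    exact smul_right_injective A (two_ne_zero (α := ℝ)) h2
  have hk : ∀ k, ∑ i, γ i * (γ i * γ k - γ k * γ i) = (-2 * ((Fintype.card ι : ℝ) - 1)) • γ k := by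
    intro k
    have : ∀ i, γ i * (γ i * γ k - γ k * γ i) =
        (-2 : ℝ) • γ k + (if i = k then (2 : ℝ) else 0) • γ k := by
      intro i
      have h1 : γ i * (γ i * γ k - γ k * γ i) = γ i * γ i * γ k - γ i * γ k * γ i := by
        noncomm_ring
      rw [h1, hγ i k, hsq]
      have h2 : γ k * γ i * γ i = (-1 : ℝ) • γ k := by rw [mul_assoc, hsq]; simp
      rw [add_mul, neg_mul, h2]
      split_ifs with h
      · subst h; simp only [smul_mul_assoc, one_mul]; module
      · simp only [smul_mul_assoc, one_mul]; module
    simp only [this, Finset.sum_add_distrib, Finset.sum_const, Finset.card_univ]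
    rw [Finset.sum_eq_single k (fun i _ hi => by simp [hi]) (by simp), if_pos rfl]
    module
  simp only [Finset.mul_sum, Finset.sum_mul, mul_smul_comm, smul_mul_assoc,
    ← Finset.sum_sub_distrib, ← smul_sub]
  rw [Finset.sum_comm, Finset.smul_sum]
  refine Finset.sum_congr rfl fun k _ => ?_
  rw [← Finset.smul_sum, hk, smul_comm]

end CliffordRelations
end KillingSpinor
end

noncomputable section
namespace KillingSpinor

/-! ### Clifford multiplication by vectors -/

namespace CliffordModule

variable {n : ℕ} {S : Type*} [NormedAddCommGroup S] [InnerProductSpace ℂ S]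
  [FiniteDimensional ℂ S]

lemma cliffordRelations (C : CliffordModule n S) : CliffordRelations C.γ := by
  intro i j
  by_cases h : i = j
  · subst h
    rw [C.γ_sq, if_pos rfl, neg_smul, two_smul]
    abel
  · rw [if_neg h, zero_smul, add_zero, C.γ_anticomm h]

lemma c_eq_sum (C : CliffordModule n S) (v : EuclideanSpace ℝ (Fin n)) :
    C.c v = ∑ j, (v j) • C.γ j := by
  have h1 : v = ∑ j, (v j) • EuclideanSpace.single j (1 : ℝ) := by
    ext i; simp [Pi.single_apply]
  conv_lhs => rw [h1]
  simp [c, γ]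

lemma c_add (C : CliffordModule n S) (v w : EuclideanSpace ℝ (Fin n)) :
    C.c (v + w) = C.c v + C.c w := by simp [c]

lemma c_smul (C : CliffordModule n S) (r : ℝ) (v : EuclideanSpace ℝ (Fin n)) :
    C.c (r • v) = r • C.c v := by simp [c]

lemma c_sub (C : CliffordModule n S) (v w : EuclideanSpace ℝ (Fin n)) :
    C.c (v - w) = C.c v - C.c w := by simp [c]

lemma c_neg (C : CliffordModule n S) (v : EuclideanSpace ℝ (Fin n)) :
    C.c (-v) = -C.c v := by simp [c]

/-- Follows from `c(v)² = -|v|²`. All conclusions about vectors are drawn from spinor equations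
through this. -/
lemma eq_zero_of_c_apply_eq_zero (C : CliffordModule n S) {v : EuclideanSpace ℝ (Fin n)} {ψ : S}
    (hψ : ψ ≠ 0) (h : C.c v ψ = 0) : v = 0 := by
  have h1 : (C.c v * C.c v) ψ = 0 := by
    change C.c v (C.c v ψ) = 0
    rw [h, map_zero]
  rw [C.c_sq] at h1
  have h2 : (-inner ℝ v v : ℝ) • ψ = 0 := h1
  rcases smul_eq_zero.1 h2 with h3 | h3
  · exact inner_self_eq_zero.1 (neg_eq_zero.1 h3)
  · exact absurd h3 hψ

end CliffordModule

/-! ### Orthonormal frames, connection forms and the spin connection -/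

section Spin

open Filter Topology

set_option linter.unusedSectionVars false

variable {n : ℕ} [NeZero n] {M : Type*} [TopologicalSpace M]
  [ChartedSpace (EuclideanHalfSpace n) M] [IsManifold (𝓡∂ n) ∞ M]
  [RiemannianBundle (fun x : M => TangentSpace (𝓡∂ n) x)]

/-- The vector field `X` is smooth at `x`. -/
abbrev SmoothVectorFieldAt (X : Π y : M, T n y) (x : M) : Prop :=
  ContMDiffAt (𝓡∂ n) ((𝓡∂ n).prod 𝓘(ℝ, EuclideanSpace ℝ (Fin n))) ∞
    (fun y => TotalSpace.mk' (EuclideanSpace ℝ (Fin n)) (E := fun x : M => T n x) y (X y)) x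

/-- The vector field `X` is differentiable at `x`. -/
abbrev DiffVectorFieldAt (X : Π y : M, T n y) (x : M) : Prop :=
  MDifferentiableAt (𝓡∂ n) ((𝓡∂ n).prod 𝓘(ℝ, EuclideanSpace ℝ (Fin n)))
    (fun y => TotalSpace.mk' (EuclideanSpace ℝ (Fin n)) (E := fun x : M => T n x) y (X y)) x

section Frames

variable {ι : Type*} (P : SpinStructure ι n M)

namespace SpinStructure

/-- The frame `e a` at a point of `U a`, as an orthonormal basis. -/
def basis (a : ι) {x : M} (hx : x ∈ P.U a) : OrthonormalBasis (Fin n) ℝ (T n x) :=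
  OrthonormalBasis.mk (P.orthonormal a x hx) (by
    have := (P.orthonormal a x hx).linearIndependent.span_eq_top_of_card_eq_finrank' (by
      rw [Fintype.card_fin]
      exact (finrank_euclideanSpace_fin (𝕜 := ℝ) (n := n)).symm)
    exact this.ge)

lemma basis_apply (a : ι) {x : M} (hx : x ∈ P.U a) (i : Fin n) : P.basis a hx i = P.e a i x := by
  simp [basis]

lemma coords_apply (a : ι) (x : M) (v : T n x) (i : Fin n) :
    P.coords a x v i = inner ℝ (P.e a i x) v := rfl

lemma sum_coords (a : ι) {x : M} (hx : x ∈ P.U a) (v : T n x) :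
    ∑ i, (inner ℝ (P.e a i x) v : ℝ) • P.e a i x = v := by
  simpa [basis_apply] using (P.basis a hx).sum_repr' v

lemma inner_eq_sum (a : ι) {x : M} (hx : x ∈ P.U a) (v w : T n x) :
    inner ℝ v w = ∑ i, (inner ℝ v (P.e a i x) * inner ℝ (P.e a i x) w : ℝ) := by
  simpa [basis_apply] using ((P.basis a hx).sum_inner_mul_inner v w).symm

lemma coords_injective (a : ι) {x : M} (hx : x ∈ P.U a) {v : T n x} (h : P.coords a x v = 0) :
    v = 0 := by
  rw [← P.sum_coords a hx v]
  refine Finset.sum_eq_zero fun i _ => ?_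
  have : P.coords a x v i = 0 := by rw [h]; rfl
  rw [coords_apply] at this
  rw [this, zero_smul]

lemma coords_add (a : ι) (x : M) (v w : T n x) :
    P.coords a x (v + w) = P.coords a x v + P.coords a x w := by
  ext i; simp [coords_apply, inner_add_right]

lemma coords_sub (a : ι) (x : M) (v w : T n x) :
    P.coords a x (v - w) = P.coords a x v - P.coords a x w := by
  ext i; simp [coords_apply, inner_sub_right]

lemma coords_smul (a : ι) (x : M) (r : ℝ) (v : T n x) :
    P.coords a x (r • v) = r • P.coords a x v := by
  ext i; simp [coords_apply, inner_smul_right]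

/-- The connection forms `⟨∇_v e_i, e_j⟩`. -/
def connForm (D : Connection n M) (a : ι) (x : M) (v : T n x) (i j : Fin n) : ℝ :=
  inner ℝ (D (P.e a i) x v) (P.e a j x)

lemma contMDiffAt_e {a : ι} {x : M} (hx : x ∈ P.U a) (i : Fin n) :
    SmoothVectorFieldAt (P.e a i) x :=
  (P.smooth_e a i).contMDiffAt ((P.isOpen_U a).mem_nhds hx)

variable [IsContMDiffRiemannianBundle (𝓡∂ n) ∞ (EuclideanSpace ℝ (Fin n))
      (fun x : M => TangentSpace (𝓡∂ n) x)] {D : Connection n M}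

/-- Metric compatibility, applied to the locally constant functions `⟨e_i, e_j⟩`. -/
lemma connForm_antisymm (hD : IsLeviCivita D) {a : ι} {x : M} (hx : x ∈ P.U a) (v : T n x)
    (i j : Fin n) : P.connForm D a x v i j = -P.connForm D a x v j i := by
  have h := hD.metric.mvfderiv_inner_eq (X := FiberBundle.extend (EuclideanSpace ℝ (Fin n)) v)
    ((P.contMDiffAt_e hx i).mdifferentiableAt (by simp))
    ((P.contMDiffAt_e hx j).mdifferentiableAt (by simp))
  have hc : (fun y => (inner ℝ (P.e a i y) (P.e a j y) : ℝ)) =ᶠ[𝓝 x]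
      fun _ => if i = j then 1 else 0 := by
    filter_upwards [(P.isOpen_U a).mem_nhds hx] with y hy
    exact orthonormal_iff_ite.1 (P.orthonormal a y hy) i j
  rw [mvfderiv_congr hc, mvfderiv_const] at h
  simp only [FiberBundle.extend_apply_self, zero_apply] at h
  rw [connForm, connForm, real_inner_comm (P.e a i x)]
  linarith

lemma mvfderiv_inner_e (hD : IsLeviCivita D) {a : ι} {x : M} (hx : x ∈ P.U a)
    {Z : Π y : M, T n y}
    (hZ : DiffVectorFieldAt Z x)
    (v : T n x) (i : Fin n) :
    mvfderiv (𝓡∂ n) (fun y => (inner ℝ (P.e a i y) (Z y) : ℝ)) x v =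
      (∑ j, P.connForm D a x v i j * P.coords a x (Z x) j) + P.coords a x (D Z x v) i := by
  have h := hD.metric.mvfderiv_inner_eq (X := FiberBundle.extend (EuclideanSpace ℝ (Fin n)) v)
    ((P.contMDiffAt_e hx i).mdifferentiableAt (by simp)) hZ
  simp only [FiberBundle.extend_apply_self] at h
  rw [h, P.inner_eq_sum a hx]
  rfl

omit [IsContMDiffRiemannianBundle (𝓡∂ n) ∞ (EuclideanSpace ℝ (Fin n))
      (fun x : M => TangentSpace (𝓡∂ n) x)] in
lemma coords_eq (a : ι) (Z : Π y : M, T n y) :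
    (fun y => P.coords a y (Z y)) = fun y => (EuclideanSpace.equiv (Fin n) ℝ).symm
      (fun i => (inner ℝ (P.e a i y) (Z y) : ℝ)) := rfl

lemma mdifferentiableAt_coords {a : ι} {x : M} (hx : x ∈ P.U a) {Z : Π y : M, T n y}
    (hZ : DiffVectorFieldAt Z x) :
    MDifferentiableAt (𝓡∂ n) 𝓘(ℝ, EuclideanSpace ℝ (Fin n)) (fun y => P.coords a y (Z y)) x := by
  have h : (fun y => P.coords a y (Z y)) = fun y => ∑ i,
      (ContinuousLinearMap.toSpanSingleton ℝ (EuclideanSpace.single i (1 : ℝ)))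
        (inner ℝ (P.e a i y) (Z y) : ℝ) := by
    ext y j
    simp [coords_apply, Pi.single_apply]
  rw [h]
  exact (mvfderiv_finsetSum _ (fun i _ => mdifferentiableAt_clm _
    (((P.contMDiffAt_e hx i).mdifferentiableAt (by simp)).inner_bundle hZ)) 0).1

lemma contMDiffAt_coords {a : ι} {x : M} (hx : x ∈ P.U a) {Z : Π y : M, T n y}
    (hZ : SmoothVectorFieldAt Z x) :
    ContMDiffAt (𝓡∂ n) 𝓘(ℝ, EuclideanSpace ℝ (Fin n)) ∞ (fun y => P.coords a y (Z y)) x := by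
  rw [coords_eq]
  refine (EuclideanSpace.equiv (Fin n) ℝ).symm.toContinuousLinearMap.contMDiff.contMDiffAt.comp x ?_
  rw [contMDiffAt_pi_space]
  exact fun i => (P.contMDiffAt_e hx i).inner_bundle hZ

lemma mvfderiv_coords (hD : IsLeviCivita D) {a : ι} {x : M} (hx : x ∈ P.U a)
    {Z : Π y : M, T n y} (hZ : DiffVectorFieldAt Z x) (v : T n x) :
    mvfderiv (𝓡∂ n) (fun y => P.coords a y (Z y)) x v =
      WithLp.toLp 2 (fun i => ∑ j, P.connForm D a x v i j * P.coords a x (Z x) j) +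
        P.coords a x (D Z x v) := by
  ext i
  rw [PiLp.add_apply, ← P.mvfderiv_inner_e hD hx hZ v i]
  exact (mvfderiv_clm (EuclideanSpace.proj i : EuclideanSpace ℝ (Fin n) →L[ℝ] ℝ)
    (P.mdifferentiableAt_coords hx hZ) v).symm

end SpinStructure

end Frames

section SpinConnection

variable {ι : Type*} (P : SpinStructure ι n M)
  {S : Type*} [NormedAddCommGroup S] [InnerProductSpace ℂ S] [FiniteDimensional ℂ S]
  (C : CliffordModule n S)

/-- Clifford multiplication by vectors as a continuous linear map. -/
def CliffordModule.cL (C : CliffordModule n S) : EuclideanSpace ℝ (Fin n) →L[ℝ] (S →L[ℂ] S) :=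
  LinearMap.toContinuousLinearMap (C.act.toLinearMap ∘ₗ vec n)

omit [NeZero n] in
lemma CliffordModule.cL_apply (C : CliffordModule n S) (v : EuclideanSpace ℝ (Fin n)) :
    C.cL v = C.c v := rfl

/-- `bivector` as a continuous linear map. -/
def CliffordModule.bivectorL (C : CliffordModule n S) :
    (Fin n → Fin n → ℝ) →L[ℝ] (S →L[ℂ] S) :=
  LinearMap.toContinuousLinearMap
    { toFun := bivector C.γ
      map_add' := fun r s => by
        simp only [bivector, Pi.add_apply, add_smul, Finset.sum_add_distrib, smul_add]
      map_smul' := fun c r => by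
        simp only [bivector, Pi.smul_apply, smul_eq_mul, mul_smul, ← Finset.smul_sum,
          RingHom.id_apply]
        rw [smul_comm] }

omit [NeZero n] in
lemma CliffordModule.bivectorL_apply (C : CliffordModule n S) (r : Fin n → Fin n → ℝ) :
    C.bivectorL r = bivector C.γ r := rfl

omit [NeZero n] in
lemma CliffordModule.bivector_comm_c (C : CliffordModule n S) {r : Fin n → Fin n → ℝ}
    (hr : ∀ i j, r i j = -r j i) (w : EuclideanSpace ℝ (Fin n)) :
    bivector C.γ r * C.c w - C.c w * bivector C.γ r =
      C.c (WithLp.toLp 2 fun j => ∑ k, w k * r k j) := by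
  rw [C.c_eq_sum w, C.c_eq_sum, Finset.mul_sum, Finset.sum_mul, ← Finset.sum_sub_distrib]
  simp only [mul_smul_comm, smul_mul_assoc, ← smul_sub, C.cliffordRelations.bivector_comm hr,
    Finset.sum_smul, Finset.smul_sum, smul_smul]
  exact Finset.sum_comm

namespace SpinStructure

/-- Clifford multiplication by a vector field, in the frame `e a`. -/
def cField (a : ι) (Z : Π y : M, T n y) (y : M) : S →L[ℂ] S := C.c (P.coords a y (Z y))

/-- The spin connection form in the frame `e a`. -/
def spinForm (D : Connection n M) (a : ι) (y : M) (v : T n y) : S →L[ℂ] S :=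
  bivector C.γ (P.connForm D a y v)

variable [IsContMDiffRiemannianBundle (𝓡∂ n) ∞ (EuclideanSpace ℝ (Fin n))
      (fun x : M => TangentSpace (𝓡∂ n) x)] {D : Connection n M}

lemma contMDiffAt_cField {a : ι} {x : M} (hx : x ∈ P.U a) {Z : Π y : M, T n y}
    (hZ : SmoothVectorFieldAt Z x) :
    ContMDiffAt (𝓡∂ n) 𝓘(ℝ, S →L[ℂ] S) ∞ (P.cField C a Z) x :=
  C.cL.contMDiff.contMDiffAt.comp x (P.contMDiffAt_coords hx hZ)

lemma mdifferentiableAt_cField {a : ι} {x : M} (hx : x ∈ P.U a) {Z : Π y : M, T n y}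
    (hZ : DiffVectorFieldAt Z x) :
    MDifferentiableAt (𝓡∂ n) 𝓘(ℝ, S →L[ℂ] S) (P.cField C a Z) x :=
  mdifferentiableAt_clm C.cL (P.mdifferentiableAt_coords hx hZ)

/-- Clifford multiplication is parallel: commutation with the spin connection form reproduces, up to
sign, the frame rotation in the derivative of the coordinates of `Z`. -/
lemma mvfderiv_cField (hD : IsLeviCivita D) {a : ι} {x : M} (hx : x ∈ P.U a)
    {Z : Π y : M, T n y} (hZ : DiffVectorFieldAt Z x) (v : T n x) :
    mvfderiv (𝓡∂ n) (P.cField C a Z) x v = C.c (P.coords a x (D Z x v)) -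
      (P.spinForm C D a x v * P.cField C a Z x - P.cField C a Z x * P.spinForm C D a x v) := by
  refine (mvfderiv_clm C.cL (P.mdifferentiableAt_coords hx hZ) v).trans ?_
  rw [P.mvfderiv_coords hD hx hZ, spinForm, cField,
    C.bivector_comm_c (P.connForm_antisymm hD hx v), C.cL_apply, C.c_add]
  have h : WithLp.toLp 2 (fun i => ∑ j, P.connForm D a x v i j * P.coords a x (Z x) j) =
      -WithLp.toLp 2 (fun j => ∑ k, P.coords a x (Z x) k * P.connForm D a x v k j) := by
    ext i
    simp only [PiLp.neg_apply, ← Finset.sum_neg_distrib]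
    refine Finset.sum_congr rfl fun j _ => ?_
    rw [P.connForm_antisymm hD hx v i j]
    ring
  rw [h, C.c_neg]
  abel

lemma smoothVectorFieldAt_extend {x y : M} (hy : y ∈ (chartAt (EuclideanHalfSpace n) x).source)
    (u : T n x) :
    SmoothVectorFieldAt (FiberBundle.extend (EuclideanSpace ℝ (Fin n)) u : Π y : M, T n y) y :=
  contMDiffAt_extend_of_mem hy u

variable [T2Space M]

lemma smoothVectorFieldAt_covariantDerivative (hD : IsLeviCivita D) {x : M}
    {σ X : Π y : M, T n y} (hσ : ∀ᶠ y in 𝓝 x, SmoothVectorFieldAt σ y)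
    (hX : ∀ᶠ y in 𝓝 x, SmoothVectorFieldAt X y) :
    SmoothVectorFieldAt (fun y => D σ y (X y)) x := by
  obtain ⟨s, hs, hso, hxs⟩ := eventually_nhds_iff.1 (hσ.and hX)
  exact (contMDiffOn_covariantDerivative_apply hD.smooth hso
    (fun y hy => (hs y hy).1.contMDiffWithinAt)
    (fun y hy => (hs y hy).2.contMDiffWithinAt)).contMDiffAt (hso.mem_nhds hxs)

lemma eventually_smoothVectorFieldAt_extend {x : M} (u : T n x) :
    ∀ᶠ y in 𝓝 x, SmoothVectorFieldAt
      (FiberBundle.extend (EuclideanSpace ℝ (Fin n)) u : Π y : M, T n y) y := by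
  filter_upwards [(chartAt (EuclideanHalfSpace n) x).open_source.mem_nhds
    (mem_chart_source (EuclideanHalfSpace n) x)] with y hy
  exact smoothVectorFieldAt_extend hy u

lemma eventually_smoothVectorFieldAt_e {a : ι} {x : M} (hx : x ∈ P.U a) (i : Fin n) :
    ∀ᶠ y in 𝓝 x, SmoothVectorFieldAt (P.e a i) y := by
  filter_upwards [(P.isOpen_U a).mem_nhds hx] with y hy
  exact P.contMDiffAt_e hy i

lemma contMDiffAt_connForm (hD : IsLeviCivita D) {a : ι} {x : M} (hx : x ∈ P.U a)
    {X : Π y : M, T n y} (hX : ∀ᶠ y in 𝓝 x, SmoothVectorFieldAt X y) :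
    ContMDiffAt (𝓡∂ n) 𝓘(ℝ, Fin n → Fin n → ℝ) ∞ (fun y => P.connForm D a y (X y)) x := by
  rw [contMDiffAt_pi_space]
  intro i
  rw [contMDiffAt_pi_space]
  intro j
  exact (smoothVectorFieldAt_covariantDerivative hD (P.eventually_smoothVectorFieldAt_e hx i)
    hX).inner_bundle (P.contMDiffAt_e hx j)

lemma contMDiffAt_spinForm (hD : IsLeviCivita D) {a : ι} {x : M} (hx : x ∈ P.U a)
    {X : Π y : M, T n y} (hX : ∀ᶠ y in 𝓝 x, SmoothVectorFieldAt X y) :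
    ContMDiffAt (𝓡∂ n) 𝓘(ℝ, S →L[ℂ] S) ∞ (fun y => P.spinForm C D a y (X y)) x :=
  C.bivectorL.contMDiff.contMDiffAt.comp x (P.contMDiffAt_connForm hD hx hX)

/-- The derivative at `x` along `u` of the connection forms applied to the local extension
of `v`. -/
def dConnForm (D : Connection n M) (a : ι) (x : M) (u v : T n x) : Fin n → Fin n → ℝ :=
  mvfderiv (𝓡∂ n) (fun y => P.connForm D a y
    (FiberBundle.extend (EuclideanSpace ℝ (Fin n)) v y)) x u

/-- The curvature forms in the frame `e a`. -/
def curvForm (D : Connection n M) (a : ι) (x : M) (u v : T n x) (i j : Fin n) : ℝ :=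
  P.dConnForm D a x u v i j - P.dConnForm D a x v u i j +
    ∑ k, (P.connForm D a x v i k * P.connForm D a x u k j -
      P.connForm D a x u i k * P.connForm D a x v k j)

lemma dConnForm_antisymm (hD : IsLeviCivita D) {a : ι} {x : M} (hx : x ∈ P.U a) (u v : T n x)
    (i j : Fin n) : P.dConnForm D a x u v i j = -P.dConnForm D a x u v j i := by
  have hω := (P.contMDiffAt_connForm hD hx
    (eventually_smoothVectorFieldAt_extend v)).mdifferentiableAt (by simp)
  have hL : ∀ i j : Fin n, P.dConnForm D a x u v i j = mvfderiv (𝓡∂ n) (fun y => P.connForm D a y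
      (FiberBundle.extend (EuclideanSpace ℝ (Fin n)) v y) i j) x u := fun i j =>
    (mvfderiv_clm ((ContinuousLinearMap.proj (R := ℝ) (φ := fun _ : Fin n => ℝ) j).comp
      (ContinuousLinearMap.proj (R := ℝ) (φ := fun _ : Fin n => Fin n → ℝ) i)) hω u).symm
  rw [hL, hL]
  have : (fun y => P.connForm D a y (FiberBundle.extend (EuclideanSpace ℝ (Fin n)) v y) i j)
      =ᶠ[𝓝 x] fun y => -P.connForm D a y (FiberBundle.extend (EuclideanSpace ℝ (Fin n)) v y) j i := by
    filter_upwards [(P.isOpen_U a).mem_nhds hx] with y hy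
    exact P.connForm_antisymm hD hy _ i j
  rw [mvfderiv_congr this, mvfderiv_fun_neg]
  rfl

lemma curvForm_antisymm (hD : IsLeviCivita D) {a : ι} {x : M} (hx : x ∈ P.U a) (u v : T n x)
    (i j : Fin n) : P.curvForm D a x u v i j = -P.curvForm D a x u v j i := by
  rw [curvForm, curvForm, P.dConnForm_antisymm hD hx u v i j, P.dConnForm_antisymm hD hx v u i j]
  have : ∀ k, P.connForm D a x v i k * P.connForm D a x u k j -
      P.connForm D a x u i k * P.connForm D a x v k j =
      -(P.connForm D a x v j k * P.connForm D a x u k i -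
      P.connForm D a x u j k * P.connForm D a x v k i) := by
    intro k
    rw [P.connForm_antisymm hD hx v i k, P.connForm_antisymm hD hx u k j,
      P.connForm_antisymm hD hx u i k, P.connForm_antisymm hD hx v k j]
    ring
  simp only [this, Finset.sum_neg_distrib]
  ring

/-- The curvature of the spin connection in the frame `e a`. -/
def spinCurvature (D : Connection n M) (a : ι) (x : M) (u v : T n x) : S →L[ℂ] S :=
  bivector C.γ (P.curvForm D a x u v)

/-- The structure equation `R = dΓ + [Γ, Γ]` is transported through the linear map `bivector`, the
quadratic term by `bivector_comm_bivector`. No bracket term appears because coordinate extensions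
commute. -/
lemma spinCurvature_eq (hD : IsLeviCivita D) {a : ι} {x : M} (hx : x ∈ P.U a) (u v : T n x) :
    P.spinCurvature C D a x u v =
      mvfderiv (𝓡∂ n) (fun y => P.spinForm C D a y
        (FiberBundle.extend (EuclideanSpace ℝ (Fin n)) v y)) x u -
      mvfderiv (𝓡∂ n) (fun y => P.spinForm C D a y
        (FiberBundle.extend (EuclideanSpace ℝ (Fin n)) u y)) x v +
      (P.spinForm C D a x u * P.spinForm C D a x v -
        P.spinForm C D a x v * P.spinForm C D a x u) := by
  have hL : ∀ u v : T n x, mvfderiv (𝓡∂ n) (fun y => P.spinForm C D a y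
      (FiberBundle.extend (EuclideanSpace ℝ (Fin n)) v y)) x u =
      C.bivectorL (P.dConnForm D a x u v) := fun u v =>
    mvfderiv_clm C.bivectorL ((P.contMDiffAt_connForm hD hx
      (eventually_smoothVectorFieldAt_extend v)).mdifferentiableAt (by simp)) u
  rw [hL, hL, spinForm, spinForm, C.cliffordRelations.bivector_comm_bivector
    (P.connForm_antisymm hD hx u), ← C.bivectorL_apply, ← map_sub, ← map_add]
  rfl

end SpinStructure

end SpinConnection

end Spin
end KillingSpinor
end

noncomputable section
namespace KillingSpinor

/-! ### The Riemann tensor and the curvature of the spin connection -/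

section Curvature

open Filter Topology

set_option linter.unusedSectionVars false

variable {n : ℕ} [NeZero n] {M : Type*} [TopologicalSpace M]
  [ChartedSpace (EuclideanHalfSpace n) M] [IsManifold (𝓡∂ n) ∞ M]
  [RiemannianBundle (fun x : M => TangentSpace (𝓡∂ n) x)]
  [IsContMDiffRiemannianBundle (𝓡∂ n) ∞ (EuclideanSpace ℝ (Fin n))
      (fun x : M => TangentSpace (𝓡∂ n) x)]
  {D : Connection n M}

/-- The local extension of a tangent vector by the vector field with constant coefficients in the
preferred chart. -/
abbrev coordExt {x : M} (u : T n x) : Π y : M, T n y :=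
  FiberBundle.extend (EuclideanSpace ℝ (Fin n)) u

lemma coordExt_self {x : M} (u : T n x) : coordExt u x = u := FiberBundle.extend_apply_self _ u

/-- Coordinate vector fields commute, so the Levi-Civita connection is symmetric on them. -/
lemma covariantDerivative_coordExt_comm (hD : IsLeviCivita D) {x y : M}
    (hy : y ∈ (chartAt (EuclideanHalfSpace n) x).source) (u v : T n x) :
    D (coordExt v) y (coordExt u y) = D (coordExt u) y (coordExt v y) := by
  have h := ((CovariantDerivative.torsion_eq_zero_iff D).1 hD.torsion_eq_zero)
    ((SpinStructure.smoothVectorFieldAt_extend hy u).mdifferentiableAt (by simp))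
    ((SpinStructure.smoothVectorFieldAt_extend hy v).mdifferentiableAt (by simp))
  rw [mlieBracket_extend_eq_zero hy] at h
  exact sub_eq_zero.1 h

lemma curvature_eq (x : M) (u v w : T n x) :
    curvature D x u v w = D (fun y => D (coordExt w) y (coordExt v y)) x u -
      D (fun y => D (coordExt w) y (coordExt u y)) x v := by
  rw [curvature, curvatureField,
    mlieBracket_extend_eq_zero (mem_chart_source (EuclideanHalfSpace n) x) u v, map_zero, sub_zero,
    FiberBundle.extend_apply_self, FiberBundle.extend_apply_self]

lemma curvature_antisymm (x : M) (u v w : T n x) :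
    curvature D x u v w = -curvature D x v u w := by
  rw [curvature_eq, curvature_eq, neg_sub]

variable [T2Space M]

lemma smoothVectorFieldAt_covariantDerivative_coordExt (hD : IsLeviCivita D) {x : M}
    (u v : T n x) : SmoothVectorFieldAt (fun y => D (coordExt v) y (coordExt u y)) x :=
  SpinStructure.smoothVectorFieldAt_covariantDerivative hD
    (SpinStructure.eventually_smoothVectorFieldAt_extend v)
    (SpinStructure.eventually_smoothVectorFieldAt_extend u)

/-- The first Bianchi identity. -/
lemma curvature_cyclic (hD : IsLeviCivita D) (x : M) (u v w : T n x) :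
    curvature D x u v w + curvature D x v w u + curvature D x w u v = 0 := by
  -- Torsion-freeness holds on a whole neighbourhood of `x`, so the symmetry of `∇_v w` may be
  -- differentiated once more; the six terms then cancel in pairs.
  have key : ∀ u v w : T n x, D (fun y => D (coordExt w) y (coordExt v y)) x u =
      D (fun y => D (coordExt v) y (coordExt w y)) x u := by
    intro u v w
    rw [D.isCovariantDerivativeOnUniv.congr_of_eventuallyEq
      ((smoothVectorFieldAt_covariantDerivative_coordExt hD v w).mdifferentiableAt (by simp))
      ((smoothVectorFieldAt_covariantDerivative_coordExt hD w v).mdifferentiableAt (by simp))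
      Filter.univ_mem]
    filter_upwards [(chartAt (EuclideanHalfSpace n) x).open_source.mem_nhds
      (mem_chart_source (EuclideanHalfSpace n) x)] with y hy
    exact covariantDerivative_coordExt_comm hD hy v w
  rw [curvature_eq, curvature_eq, curvature_eq, key u v w, key v w u, key w u v]
  abel

variable {S : Type*} [NormedAddCommGroup S] [InnerProductSpace ℂ S] [FiniteDimensional ℂ S]

/-- Composition of operators as a real bilinear map. -/
def opMul (S : Type*) [NormedAddCommGroup S] [InnerProductSpace ℂ S] :
    (S →L[ℂ] S) →L[ℝ] (S →L[ℂ] S) →L[ℝ] (S →L[ℂ] S) :=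
  (ContinuousLinearMap.compL ℂ S S S).bilinearRestrictScalars ℝ

/-- Application of operators as a real bilinear map. -/
def opApply (S : Type*) [NormedAddCommGroup S] [InnerProductSpace ℂ S] :
    (S →L[ℂ] S) →L[ℝ] S →L[ℝ] S :=
  (ContinuousLinearMap.id ℂ (S →L[ℂ] S)).bilinearRestrictScalars ℝ

lemma mvfderiv_op_mul {f g : M → S →L[ℂ] S} {x : M}
    (hf : MDifferentiableAt (𝓡∂ n) 𝓘(ℝ, S →L[ℂ] S) f x)
    (hg : MDifferentiableAt (𝓡∂ n) 𝓘(ℝ, S →L[ℂ] S) g x) (v : T n x) :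
    MDifferentiableAt (𝓡∂ n) 𝓘(ℝ, S →L[ℂ] S) (fun y => f y * g y) x ∧
    mvfderiv (𝓡∂ n) (fun y => f y * g y) x v =
      mvfderiv (𝓡∂ n) f x v * g x + f x * mvfderiv (𝓡∂ n) g x v :=
  ⟨mdifferentiableAt_clm_apply₂ (opMul S) hf hg, mvfderiv_clm_apply₂ (opMul S) hf hg v⟩

lemma mvfderiv_op_apply {f : M → S →L[ℂ] S} {g : M → S} {x : M}
    (hf : MDifferentiableAt (𝓡∂ n) 𝓘(ℝ, S →L[ℂ] S) f x)
    (hg : MDifferentiableAt (𝓡∂ n) 𝓘(ℝ, S) g x) (v : T n x) :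
    MDifferentiableAt (𝓡∂ n) 𝓘(ℝ, S) (fun y => f y (g y)) x ∧
    mvfderiv (𝓡∂ n) (fun y => f y (g y)) x v =
      mvfderiv (𝓡∂ n) f x v (g x) + f x (mvfderiv (𝓡∂ n) g x v) :=
  ⟨mdifferentiableAt_clm_apply₂ (opApply S) hf hg, mvfderiv_clm_apply₂ (opApply S) hf hg v⟩

lemma mvfderiv_sub_op_comm {f g k : M → S →L[ℂ] S} {x : M}
    (hk : MDifferentiableAt (𝓡∂ n) 𝓘(ℝ, S →L[ℂ] S) k x)
    (hf : MDifferentiableAt (𝓡∂ n) 𝓘(ℝ, S →L[ℂ] S) f x)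
    (hg : MDifferentiableAt (𝓡∂ n) 𝓘(ℝ, S →L[ℂ] S) g x) (v : T n x) :
    mvfderiv (𝓡∂ n) (fun y => k y - (f y * g y - g y * f y)) x v = mvfderiv (𝓡∂ n) k x v -
      ((mvfderiv (𝓡∂ n) f x v * g x + f x * mvfderiv (𝓡∂ n) g x v) -
        (mvfderiv (𝓡∂ n) g x v * f x + g x * mvfderiv (𝓡∂ n) f x v)) := by
  have h1 := mvfderiv_op_mul hf hg v
  have h2 := mvfderiv_op_mul hg hf v
  have h3 := mvfderiv_fun_sub h1.1 h2.1
  have h4 := mvfderiv_fun_sub hk (h1.1.sub h2.1)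
  rw [← h1.2, ← h2.2, ← sub_apply, ← h3]
  exact congr($h4 v)

variable {ι : Type*} (P : SpinStructure ι n M) (C : CliffordModule n S)

namespace SpinStructure

/-- The curvature of the spin connection acts on Clifford multiplication by the Riemann curvature
tensor. -/
lemma c_curvature (hD : IsLeviCivita D) {a : ι} {x : M} (hx : x ∈ P.U a) (u v w : T n x) :
    C.c (P.coords a x (curvature D x u v w)) =
      P.spinCurvature C D a x u v * C.c (P.coords a x w) -
        C.c (P.coords a x w) * P.spinCurvature C D a x u v := by
  have key : ∀ u v : T n x,
      mvfderiv (𝓡∂ n) (fun y => mvfderiv (𝓡∂ n) (P.cField C a (coordExt w)) y (coordExt v y)) x u =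
      (C.c (P.coords a x (D (fun y => D (coordExt w) y (coordExt v y)) x u)) -
        (P.spinForm C D a x u * C.c (P.coords a x (D (coordExt w) x v)) -
          C.c (P.coords a x (D (coordExt w) x v)) * P.spinForm C D a x u)) -
      ((mvfderiv (𝓡∂ n) (fun y => P.spinForm C D a y (coordExt v y)) x u * C.c (P.coords a x w) +
        P.spinForm C D a x v * (C.c (P.coords a x (D (coordExt w) x u)) -
          (P.spinForm C D a x u * C.c (P.coords a x w) -
            C.c (P.coords a x w) * P.spinForm C D a x u))) -
       ((C.c (P.coords a x (D (coordExt w) x u)) -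
          (P.spinForm C D a x u * C.c (P.coords a x w) -
            C.c (P.coords a x w) * P.spinForm C D a x u)) * P.spinForm C D a x v +
        C.c (P.coords a x w) *
          mvfderiv (𝓡∂ n) (fun y => P.spinForm C D a y (coordExt v y)) x u)) := by
    intro u v
    have hev : (fun y => mvfderiv (𝓡∂ n) (P.cField C a (coordExt w)) y (coordExt v y)) =ᶠ[𝓝 x]
        fun y => P.cField C a (fun y => D (coordExt w) y (coordExt v y)) y -
          (P.spinForm C D a y (coordExt v y) * P.cField C a (coordExt w) y -
            P.cField C a (coordExt w) y * P.spinForm C D a y (coordExt v y)) := by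
      filter_upwards [(P.isOpen_U a).mem_nhds hx, eventually_smoothVectorFieldAt_extend w]
        with y hy hwy
      exact P.mvfderiv_cField C hD hy (hwy.mdifferentiableAt (by simp)) _
    have hDW := (smoothVectorFieldAt_covariantDerivative_coordExt hD v w).mdifferentiableAt
      (by simp)
    have hW := (eventually_smoothVectorFieldAt_extend w).self_of_nhds.mdifferentiableAt (by simp)
    have hΓ := (P.contMDiffAt_spinForm C hD hx
      (eventually_smoothVectorFieldAt_extend v)).mdifferentiableAt (by simp)
    have hcDW := P.mdifferentiableAt_cField C hx hDW
    have hcW := P.mdifferentiableAt_cField C hx hW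
    rw [mvfderiv_congr hev]
    refine (mvfderiv_sub_op_comm hcDW hΓ hcW u).trans ?_
    rw [P.mvfderiv_cField C hD hx hDW, P.mvfderiv_cField C hD hx hW]
    simp only [cField, FiberBundle.extend_apply_self]
  -- Antisymmetrizing the second derivative of `c(W)` gives zero. The terms with first derivatives
  -- of `W` cancel, leaving `c(R(u,v)w) - [R^S(u,v), c(w)]`.
  have hcomm := mvfderiv_mvfderiv_extend_comm (P.contMDiffAt_cField C hx
    (eventually_smoothVectorFieldAt_extend w).self_of_nhds) u v
  rw [key u v, key v u] at hcomm
  rw [curvature_eq, P.coords_sub, C.c_sub, P.spinCurvature_eq C hD hx, ← sub_eq_zero]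
  rw [← sub_eq_zero] at hcomm
  rw [← hcomm]
  noncomm_ring

include C in
-- `c_curvature` and the commutator formula for bivectors compute the same operator, and Clifford
-- multiplication on a nonzero spinor is injective. The value at `x` is thereby seen to be linear in
-- `w`.
lemma coords_curvature [Nontrivial S] (hD : IsLeviCivita D) {a : ι} {x : M} (hx : x ∈ P.U a)
    (u v w : T n x) :
    P.coords a x (curvature D x u v w) =
      WithLp.toLp 2 fun j => ∑ k, P.coords a x w k * P.curvForm D a x u v k j := by
  obtain ⟨ψ, hψ⟩ := exists_ne (0 : S)
  rw [← sub_eq_zero]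
  refine C.eq_zero_of_c_apply_eq_zero hψ ?_
  rw [C.c_sub, P.c_curvature C hD hx, spinCurvature,
    C.bivector_comm_c (P.curvForm_antisymm hD hx u v), sub_self, zero_apply]

end SpinStructure

end Curvature
end KillingSpinor
end

noncomputable section
namespace KillingSpinor

/-! ### Curvature symmetries and the Ricci tensor -/

section Ricci

open Filter Topology

set_option linter.unusedSectionVars false

variable {n : ℕ} [NeZero n] {M : Type*} [TopologicalSpace M]
  [ChartedSpace (EuclideanHalfSpace n) M] [IsManifold (𝓡∂ n) ∞ M]
  [RiemannianBundle (fun x : M => TangentSpace (𝓡∂ n) x)]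
  [IsContMDiffRiemannianBundle (𝓡∂ n) ∞ (EuclideanSpace ℝ (Fin n))
      (fun x : M => TangentSpace (𝓡∂ n) x)]
  {D : Connection n M} [T2Space M]
  {S : Type*} [NormedAddCommGroup S] [InnerProductSpace ℂ S] [FiniteDimensional ℂ S]
  {ι : Type*} (P : SpinStructure ι n M) (C : CliffordModule n S)

namespace SpinStructure

lemma coords_e {a : ι} {x : M} (hx : x ∈ P.U a) (i : Fin n) :
    P.coords a x (P.e a i x) = EuclideanSpace.single i 1 := by
  ext j
  rw [coords_apply, orthonormal_iff_ite.1 (P.orthonormal a x hx) j i]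
  simp

include C in
lemma inner_curvature [Nontrivial S] (hD : IsLeviCivita D) {a : ι} {x : M} (hx : x ∈ P.U a)
    (u v w z : T n x) :
    inner ℝ (curvature D x u v w) z =
      ∑ j, (∑ k, P.coords a x w k * P.curvForm D a x u v k j) * P.coords a x z j := by
  rw [P.inner_eq_sum a hx]
  refine Finset.sum_congr rfl fun j _ => ?_
  rw [real_inner_comm, ← P.coords_apply, P.coords_curvature C hD hx u v w]
  rfl

include C in
lemma inner_curvature_e [Nontrivial S] (hD : IsLeviCivita D) {a : ι} {x : M} (hx : x ∈ P.U a)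
    (u v : T n x) (k j : Fin n) :
    inner ℝ (curvature D x u v (P.e a k x)) (P.e a j x) = P.curvForm D a x u v k j := by
  rw [P.inner_curvature C hD hx]
  simp [P.coords_e hx]

include P C in
lemma inner_curvature_antisymm [Nontrivial S] (hD : IsLeviCivita D) (x : M) (u v w z : T n x) :
    (inner ℝ (curvature D x u v w) z : ℝ) = -inner ℝ (curvature D x u v z) w := by
  obtain ⟨a, hx⟩ := P.cover x
  rw [P.inner_curvature C hD hx, P.inner_curvature C hD hx]
  simp only [Finset.sum_mul]
  rw [Finset.sum_comm, ← Finset.sum_neg_distrib]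
  refine Finset.sum_congr rfl fun k _ => ?_
  rw [← Finset.sum_neg_distrib]
  refine Finset.sum_congr rfl fun j _ => ?_
  rw [P.curvForm_antisymm hD hx u v k j]
  ring

include P C in
-- The classical combination of four Bianchi identities with antisymmetry in the first and in the
-- last pair of arguments.
lemma inner_curvature_pair_symm [Nontrivial S] (hD : IsLeviCivita D) (x : M) (u v w z : T n x) :
    (inner ℝ (curvature D x u v w) z : ℝ) = inner ℝ (curvature D x w z u) v := by
  have b : ∀ u v w z : T n x, (inner ℝ (curvature D x u v w) z + inner ℝ (curvature D x v w u) z +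
      inner ℝ (curvature D x w u v) z : ℝ) = 0 := by
    intro u v w z
    rw [← inner_add_left, ← inner_add_left, curvature_cyclic hD, inner_zero_left]
  have s : ∀ u v w z : T n x, (inner ℝ (curvature D x u v w) z : ℝ) =
      -inner ℝ (curvature D x v u w) z := by
    intro u v w z
    rw [curvature_antisymm, inner_neg_left]
  have t := P.inner_curvature_antisymm C hD x
  linarith [b u v w z, b v w z u, b w z u v, b z u v w, s u v w z, s v w u z, s w u v z,
    t u v w z, t v w u z, t w u v z, s v w z u, s w z v u, s z v w u, t v w z u, t w z v u,
    t z v w u, s w z u v, s z u w v, s u w z v, t w z u v, t z u w v, t u w z v,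
    s z u v w, s u v z w, s v z u w, t z u v w, t u v z w, t v z u w, t v u w z, t w v u z,
    t u w v z, t w v z u, t z w v u, t v z w u, t z w u v, t u z w v, t w u z v, t u z v w,
    t v u z w, t z v u w]

include P C in
/-- The Ricci tensor computed in the frame `e a`. -/
lemma ricci_eq_sum [Nontrivial S] (hD : IsLeviCivita D) {a : ι} {x : M} (hx : x ∈ P.U a)
    (v w : T n x) :
    ricci D x v w = ∑ i, inner ℝ (curvature D x (P.e a i x) v w) (P.e a i x) := by
  have hs := P.inner_curvature_pair_symm C hD x
  -- Linearity in the first slot is obtained by using pair symmetry to move `s` out of the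
  -- differentiation directions. The Ricci sum is then a trace, independent of the orthonormal
  -- basis.
  let L : T n x →ₗ[ℝ] T n x :=
    { toFun := fun s => curvature D x s v w
      map_add' := fun s t => ext_inner_right ℝ fun z => by
        rw [inner_add_left, hs, hs s, hs t, P.inner_curvature_antisymm C hD,
          P.inner_curvature_antisymm C hD x w z s, P.inner_curvature_antisymm C hD x w z t,
          inner_add_right]
        ring
      map_smul' := fun r s => ext_inner_right ℝ fun z => by
        rw [RingHom.id_apply, real_inner_smul_left, hs, hs s, P.inner_curvature_antisymm C hD,
          P.inner_curvature_antisymm C hD x w z s, real_inner_smul_right]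
        ring }
  have h1 := L.trace_eq_sum_inner (stdOrthonormalBasis ℝ (T n x))
  have h2 := L.trace_eq_sum_inner (P.basis a hx)
  simp only [basis_apply] at h2
  rw [ricci]
  simp only [real_inner_comm] at h1 h2 ⊢
  exact h1.symm.trans h2

end SpinStructure

/-! ### Integrability of the Killing equation and the Einstein condition -/

namespace SpinorField

variable {P C} (Ψ : SpinorField P C)

/-- The form of the linear system `dΨ = BΨ` satisfied by an imaginary Killing spinor. -/
def killingForm (C : CliffordModule n S) (P : SpinStructure ι n M) (D : Connection n M) (ε : ℝ)
    (a : ι) (x : M) (v : T n x) : S →L[ℂ] S :=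
  -P.spinForm C D a x v - ((ε : ℂ) * (Complex.I / 2)) • C.c (P.coords a x v)

lemma nabla_eq (a : ι) (x : M) (v : T n x) :
    Ψ.nabla D a x v = mvfderiv (𝓡∂ n) (Ψ.toFun a) x v + P.spinForm C D a x v (Ψ.toFun a x) := by
  rw [nabla, SpinStructure.spinForm, bivector]
  simp only [smul_apply, sum_apply]
  rfl

lemma IsImaginaryKilling.mvfderiv_eq {Ψ : SpinorField P C} {ε : ℝ}
    (hK : Ψ.IsImaginaryKilling D ε) {a : ι} {x : M} (hx : x ∈ P.U a) (v : T n x) :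
    mvfderiv (𝓡∂ n) (Ψ.toFun a) x v = killingForm C P D ε a x v (Ψ.toFun a x) := by
  have h := hK a x hx v
  rw [nabla_eq] at h
  rw [killingForm, sub_apply, neg_apply, smul_apply]
  rw [add_assoc] at h
  rw [eq_neg_of_add_eq_zero_left h]
  abel

lemma contMDiffAt_toFun {a : ι} {x : M} (hx : x ∈ P.U a) :
    ContMDiffAt (𝓡∂ n) 𝓘(ℝ, S) ∞ (Ψ.toFun a) x :=
  (Ψ.smooth a).contMDiffAt ((P.isOpen_U a).mem_nhds hx)

lemma mdifferentiableAt_killingForm (hD : IsLeviCivita D) (ε : ℝ) {a : ι} {x : M}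
    (hx : x ∈ P.U a) (v : T n x) :
    MDifferentiableAt (𝓡∂ n) 𝓘(ℝ, S →L[ℂ] S)
      (fun y => killingForm C P D ε a y (coordExt v y)) x := by
  have hΓ := (P.contMDiffAt_spinForm C hD hx
    (SpinStructure.eventually_smoothVectorFieldAt_extend v)).mdifferentiableAt (by simp)
  have hc := P.mdifferentiableAt_cField C hx
    ((SpinStructure.eventually_smoothVectorFieldAt_extend v).self_of_nhds.mdifferentiableAt
      (by simp))
  exact hΓ.neg.sub (mdifferentiableAt_clm
    (((ε : ℂ) * (Complex.I / 2)) • ContinuousLinearMap.id ℝ (S →L[ℂ] S)) hc)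

lemma mvfderiv_killingForm (hD : IsLeviCivita D) (ε : ℝ) {a : ι} {x : M}
    (hx : x ∈ P.U a) (u v : T n x) :
    mvfderiv (𝓡∂ n) (fun y => killingForm C P D ε a y (coordExt v y)) x u =
      -mvfderiv (𝓡∂ n) (fun y => P.spinForm C D a y (coordExt v y)) x u -
        ((ε : ℂ) * (Complex.I / 2)) • (C.c (P.coords a x (D (coordExt v) x u)) -
          (P.spinForm C D a x u * C.c (P.coords a x v) -
            C.c (P.coords a x v) * P.spinForm C D a x u)) := by
  have hΓ := (P.contMDiffAt_spinForm C hD hx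
    (SpinStructure.eventually_smoothVectorFieldAt_extend v)).mdifferentiableAt (by simp)
  have hv := ((SpinStructure.eventually_smoothVectorFieldAt_extend v).self_of_nhds.mdifferentiableAt
      (by simp))
  have hc := P.mdifferentiableAt_cField C hx hv
  have h1 := mvfderiv_clm (((ε : ℂ) * (Complex.I / 2)) • ContinuousLinearMap.id ℝ (S →L[ℂ] S)) hc u
  have h2 := mvfderiv_fun_sub hΓ.neg (mdifferentiableAt_clm
    (((ε : ℂ) * (Complex.I / 2)) • ContinuousLinearMap.id ℝ (S →L[ℂ] S)) hc)
  have h3 := mvfderiv_fun_neg (I := 𝓡∂ n)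
    (g := fun y => P.spinForm C D a y (FiberBundle.extend (EuclideanSpace ℝ (Fin n)) v y)) (x := x)
  refine (congr($h2 u)).trans ?_
  rw [sub_apply, h1, P.mvfderiv_cField C hD hx hv]
  congr 1
  · exact congr($h3 u)
  · simp [SpinStructure.cField, coordExt]

/-- The integrability condition for imaginary Killing spinors. -/
lemma IsImaginaryKilling.spinCurvature_apply (hD : IsLeviCivita D) {Ψ : SpinorField P C} {ε : ℝ}
    (hε : ε * ε = 1) (hK : Ψ.IsImaginaryKilling D ε) {a : ι} {x : M} (hx : x ∈ P.U a)
    (u v : T n x) :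
    P.spinCurvature C D a x u v (Ψ.toFun a x) = (1 / 4 : ℝ) •
      (C.c (P.coords a x u) * C.c (P.coords a x v) -
        C.c (P.coords a x v) * C.c (P.coords a x u)) (Ψ.toFun a x) := by
  have hΨ := Ψ.contMDiffAt_toFun hx
  have key : ∀ u v : T n x,
      mvfderiv (𝓡∂ n) (fun y => mvfderiv (𝓡∂ n) (Ψ.toFun a) y (coordExt v y)) x u =
      (mvfderiv (𝓡∂ n) (fun y => killingForm C P D ε a y (coordExt v y)) x u +
        killingForm C P D ε a x v * killingForm C P D ε a x u) (Ψ.toFun a x) := by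
    intro u v
    have hev : (fun y => mvfderiv (𝓡∂ n) (Ψ.toFun a) y (coordExt v y)) =ᶠ[𝓝 x]
        fun y => killingForm C P D ε a y (coordExt v y) (Ψ.toFun a y) := by
      filter_upwards [(P.isOpen_U a).mem_nhds hx] with y hy
      exact hK.mvfderiv_eq hy _
    rw [mvfderiv_congr hev, (mvfderiv_op_apply (mdifferentiableAt_killingForm hD ε hx v)
      (hΨ.mdifferentiableAt (by simp)) u).2, hK.mvfderiv_eq hx, coordExt_self]
    rfl
  have hcomm := mvfderiv_mvfderiv_extend_comm hΨ u v
  rw [key u v, key v u, ← sub_eq_zero, ← sub_apply, mvfderiv_killingForm hD ε hx,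
    mvfderiv_killingForm hD ε hx] at hcomm
  -- Vanishing torsion cancels the terms `c(∇_u v) - c(∇_v u)`.
  have hsym := covariantDerivative_coordExt_comm hD (mem_chart_source (EuclideanHalfSpace n) x) u v
  rw [coordExt_self, coordExt_self] at hsym
  rw [hsym] at hcomm
  -- The sign that makes the Ricci curvature negative: the Killing constant is imaginary.
  have hμ : ((ε : ℂ) * (Complex.I / 2)) * ((ε : ℂ) * (Complex.I / 2)) = -(1 / 4 : ℂ) := by
    have : ((ε : ℂ) * ε) = 1 := by exact_mod_cast hε
    linear_combination (Complex.I ^ 2 / 4) * this + (1 / 4) * Complex.I_sq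
  rw [← sub_eq_zero, ← smul_apply, ← sub_apply, P.spinCurvature_eq C hD hx]
  rw [← neg_eq_zero, ← neg_apply] at hcomm
  rw [← hcomm]
  congr 1
  simp only [killingForm, sub_mul, mul_sub, neg_mul, mul_neg, smul_mul_assoc, mul_smul_comm,
    smul_smul, hμ, smul_sub]
  have : ∀ z : S →L[ℂ] S, (1 / 4 : ℝ) • z = (1 / 4 : ℂ) • z := fun z => by
    rw [← Complex.coe_smul]; norm_num
  simp only [this]
  module

/-- A manifold carrying an imaginary Killing spinor is Einstein at the points where the spinor does
not vanish. -/
lemma IsImaginaryKilling.ricci_eq (hD : IsLeviCivita D) {Ψ : SpinorField P C} {ε : ℝ}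
    (hε : ε * ε = 1) (hK : Ψ.IsImaginaryKilling D ε) {a : ι} {x : M} (hx : x ∈ P.U a)
    (h0 : Ψ.toFun a x ≠ 0) (v w : T n x) :
    ricci D x v w = -((n : ℝ) - 1) * inner ℝ v w := by
  have : Nontrivial S := ⟨_, _, h0⟩
  set p : Fin n → Fin n → Fin n → ℝ := fun i k j => P.curvForm D a x (P.e a i x) v k j with hp
  -- The cyclic hypothesis is Bianchi: pair symmetry rewrites `⟨R(e_i,v)e_k, e_j⟩` as
  -- `⟨R(e_k,e_j)e_i, v⟩`.
  have hc := C.cliffordRelations.sum_cyclic (P := p)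
    (fun i k j => P.curvForm_antisymm hD hx _ _ _ _) (fun i k j => by
      simp only [hp, ← P.inner_curvature_e C hD hx]
      have h := P.inner_curvature_pair_symm C hD x
      have hb := congr(inner ℝ $(curvature_cyclic hD x (P.e a i x) (P.e a k x) (P.e a j x)) v)
      rw [inner_add_left, inner_add_left, inner_zero_left] at hb
      linarith [h (P.e a i x) v (P.e a k x) (P.e a j x), h (P.e a k x) v (P.e a j x) (P.e a i x),
        h (P.e a j x) v (P.e a i x) (P.e a k x)])
  have hm := C.cliffordRelations.sum_mul_comm (P.coords a x v)
  rw [← C.c_eq_sum] at hm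
  -- The Clifford trace of the integrability condition over the frame.
  have h1 : (∑ i, C.γ i * P.spinCurvature C D a x (P.e a i x) v) (Ψ.toFun a x) =
      (∑ i, C.γ i * ((1 / 4 : ℝ) • (C.γ i * C.c (P.coords a x v) -
        C.c (P.coords a x v) * C.γ i))) (Ψ.toFun a x) := by
    rw [sum_apply, sum_apply]
    refine Finset.sum_congr rfl fun i _ => ?_
    have h := hK.spinCurvature_apply hD hε hx (P.e a i x) v
    rw [P.coords_e hx] at h
    exact congrArg (C.γ i) h
  have h2 : ∑ i, C.γ i * P.spinCurvature C D a x (P.e a i x) v = (1 / 4 : ℝ) •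
      ∑ i, ∑ k, ∑ j, p i k j • (C.γ i * C.γ k * C.γ j) := by
    simp only [SpinStructure.spinCurvature, bivector, mul_smul_comm, Finset.mul_sum,
      Finset.smul_sum, mul_assoc, hp]
  have h3 : ∑ k, ∑ i, p i k i • C.γ k = C.c (WithLp.toLp 2 fun k => ∑ i, p i k i) := by
    rw [C.c_eq_sum]
    simp only [Finset.sum_smul]
  simp only [mul_smul_comm, ← Finset.smul_sum] at h1
  rw [h2, hc, hm, h3, ← sub_eq_zero, ← sub_apply, ← smul_sub, smul_apply] at h1
  have h4 : C.c ((2 : ℝ) • (WithLp.toLp 2 fun k => ∑ i, p i k i) -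
      (-2 * ((Fintype.card (Fin n) : ℝ) - 1)) • P.coords a x v) (Ψ.toFun a x) = 0 := by
    rw [C.c_sub, C.c_smul, C.c_smul]
    exact (smul_eq_zero.1 h1).resolve_left (by norm_num)
  have h5 := C.eq_zero_of_c_apply_eq_zero h0 h4
  have h6 : ∀ k, ∑ i, p i k i = -((n : ℝ) - 1) * P.coords a x v k := by
    intro k
    have : ((2 : ℝ) • (WithLp.toLp 2 fun k => ∑ i, p i k i) -
      (-2 * ((Fintype.card (Fin n) : ℝ) - 1)) • P.coords a x v) k = 0 := by rw [h5]; rfl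
    simp at this
    linarith
  rw [P.ricci_eq_sum C hD hx]
  simp only [P.inner_curvature C hD hx, P.coords_e hx]
  have h7 : ∀ i, ∑ j, (∑ k, P.coords a x w k * P.curvForm D a x (P.e a i x) v k j) *
      (EuclideanSpace.single i (1 : ℝ)) j = ∑ k, P.coords a x w k * p i k i := by
    intro i
    simp [hp]
  simp only [h7]
  rw [Finset.sum_comm]
  simp only [← Finset.mul_sum, h6]
  rw [P.inner_eq_sum a hx, Finset.mul_sum]
  refine Finset.sum_congr rfl fun k _ => ?_
  rw [P.coords_apply, P.coords_apply, real_inner_comm v (P.e a k x)]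
  ring

end SpinorField

end Ricci
end KillingSpinor
end

noncomputable section
namespace KillingSpinor

/-! ### Killing spinors have no zeros -/

section NonVanishing

open Filter Topology

set_option linter.unusedSectionVars false

/-- Grönwall on the segment from `z₀` to `z₁`, which convexity keeps inside `s`. -/
lemma eq_zero_of_norm_fderivWithin_le {E V : Type*} [NormedAddCommGroup E] [NormedSpace ℝ E]
    [NormedAddCommGroup V] [NormedSpace ℝ V] {s : Set E} (hs : Convex ℝ s) {f : E → V}
    {f' : E → E →L[ℝ] V} (hf : ∀ z ∈ s, HasFDerivWithinAt f (f' z) s z) {K : ℝ}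
    (hK : ∀ z ∈ s, ∀ w, ‖f' z w‖ ≤ K * ‖w‖ * ‖f z‖) {z₀ z₁ : E} (h₀ : z₀ ∈ s) (h₁ : z₁ ∈ s)
    (h : f z₀ = 0) : f z₁ = 0 := by
  have hmem : MapsTo (fun t : ℝ => AffineMap.lineMap z₀ z₁ t) (Icc 0 1) s := fun t ht =>
    hs.segment_subset h₀ h₁ (segment_eq_image_lineMap ℝ z₀ z₁ ▸ mem_image_of_mem _ ht)
  have hd : ∀ t ∈ Icc (0 : ℝ) 1, HasDerivWithinAt (fun t : ℝ => f (AffineMap.lineMap z₀ z₁ t))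
      (f' (AffineMap.lineMap z₀ z₁ t) (z₁ - z₀)) (Icc 0 1) t := fun t ht =>
    (hf _ (hmem ht)).comp_hasDerivWithinAt t AffineMap.hasDerivWithinAt_lineMap hmem
  have := eq_zero_of_abs_deriv_le_mul_abs_self_of_eq_zero_right (K := K * ‖z₁ - z₀‖)
    (fun t ht => (hd t ht).continuousWithinAt)
    (fun t ht => (hd t (Ico_subset_Icc_self ht)).mono_of_mem_nhdsWithin
      (Icc_mem_nhdsGE_of_mem ht)) (by simpa using h)
    (fun t ht => hK _ (hmem (Ico_subset_Icc_self ht)) _) 1 (right_mem_Icc.2 zero_le_one)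
  simpa using this

variable {n : ℕ} [NeZero n] {M : Type*} [TopologicalSpace M]
  [ChartedSpace (EuclideanHalfSpace n) M] [IsManifold (𝓡∂ n) ∞ M]
  [RiemannianBundle (fun x : M => TangentSpace (𝓡∂ n) x)]
  [IsContMDiffRiemannianBundle (𝓡∂ n) ∞ (EuclideanSpace ℝ (Fin n))
      (fun x : M => TangentSpace (𝓡∂ n) x)]
  {D : Connection n M} [T2Space M]
  {S : Type*} [NormedAddCommGroup S] [InnerProductSpace ℂ S] [FiniteDimensional ℂ S]
  {ι : Type*} {P : SpinStructure ι n M} {C : CliffordModule n S}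

namespace SpinorField

lemma IsImaginaryKilling.eventually_eq_zero (hD : IsLeviCivita D) {Ψ : SpinorField P C} {ε : ℝ}
    (hK : Ψ.IsImaginaryKilling D ε) {a : ι} {x : M} (hx : x ∈ P.U a) (h0 : Ψ.toFun a x = 0) :
    ∀ᶠ y in 𝓝 x, Ψ.toFun a y = 0 := by
  let w : Fin n → T n x := fun i => (EuclideanSpace.single i (1 : ℝ) : EuclideanSpace ℝ (Fin n))
  let B : Fin n → M → S →L[ℂ] S := fun i y => killingForm C P D ε a y (coordExt (w i) y)
  -- By continuity this bounds the form on each coordinate field near `x`; linearity of the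
  -- differential then gives the Grönwall constant `∑ i, K i`.
  let K : Fin n → ℝ := fun i => ‖B i x‖ + 1
  have hB : ∀ᶠ y in 𝓝 x, ∀ i, ‖B i y‖ ≤ K i := by
    refine eventually_all.2 fun i => ?_
    have hc := (mdifferentiableAt_killingForm (C := C) hD ε hx (w i)).continuousAt.norm
    exact (hc.eventually_lt_const (lt_add_one ‖B i x‖)).mono fun y hy => hy.le
  set φ := extChartAt (𝓡∂ n) x with hφ
  have hgood : ∀ᶠ y in 𝓝 x, (∀ i, ‖B i y‖ ≤ K i) ∧ y ∈ P.U a :=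
    hB.and ((P.isOpen_U a).mem_nhds hx)
  have hpull : ∀ᶠ z in 𝓝[range (𝓡∂ n)] (φ x),
      z ∈ φ.target ∧ (∀ i, ‖B i (φ.symm z)‖ ≤ K i) ∧ φ.symm z ∈ P.U a := by
    refine Filter.Eventually.and (extChartAt_target_mem_nhdsWithin (I := 𝓡∂ n) x) ?_
    have hc : Tendsto φ.symm (𝓝[range (𝓡∂ n)] (φ x)) (𝓝 x) := by
      have := (continuousAt_extChartAt_symm (I := 𝓡∂ n) x)
      rw [ContinuousAt, extChartAt_to_inv] at this
      exact this.mono_left nhdsWithin_le_nhds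
    exact hc.eventually hgood
  obtain ⟨r, hr, hball⟩ := Metric.mem_nhdsWithin_iff.1 hpull
  set s := Metric.ball (φ x) r ∩ range (𝓡∂ n) with hs
  -- At a boundary point this is only part of a ball, but it is still convex, so interior and
  -- boundary points need no separate treatment.
  have hconv : Convex ℝ s := (convex_ball _ _).inter (𝓡∂ n).convex_range
  have key : ∀ z ∈ s, Ψ.toFun a (φ.symm z) = 0 := by
    intro z hz
    have hder : ∀ z ∈ s, HasFDerivWithinAt (Ψ.toFun a ∘ φ.symm)
        (fderivWithin ℝ (Ψ.toFun a ∘ φ.symm) (range (𝓡∂ n)) z) s z ∧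
        ∀ i, ‖fderivWithin ℝ (Ψ.toFun a ∘ φ.symm) (range (𝓡∂ n)) z (toModel (w i))‖ ≤
          K i * ‖(Ψ.toFun a ∘ φ.symm) z‖ := by
      intro z hz
      obtain ⟨hzt, hBz, hzU⟩ := hball hz
      have hsrc : φ.symm z ∈ (chartAt (EuclideanHalfSpace n) x).source := by
        rw [← extChartAt_source (𝓡∂ n)]
        exact φ.map_target hzt
      have h := mvfderiv_eq_fderivWithin hsrc
        ((Ψ.contMDiffAt_toFun hzU).mdifferentiableAt (by simp))
      rw [← hφ, φ.right_inv hzt] at h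
      refine ⟨(h 0).1.hasFDerivWithinAt.mono inter_subset_right, fun i => ?_⟩
      have hi : killingForm C P D ε a (φ.symm z) (coordExt (w i) (φ.symm z))
          (Ψ.toFun a (φ.symm z)) =
          fderivWithin ℝ (Ψ.toFun a ∘ φ.symm) (range (𝓡∂ n)) z (toModel (w i)) :=
        (hK.mvfderiv_eq hzU _).symm.trans ((h _).2.trans
          (congrArg (fderivWithin ℝ (Ψ.toFun a ∘ φ.symm) (range (𝓡∂ n)) z)
            (coordField_extend hsrc (w i))))
      rw [← hi]
      exact ((B i (φ.symm z)).le_opNorm _).trans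
        (mul_le_mul_of_nonneg_right (hBz i) (norm_nonneg _))
    refine eq_zero_of_norm_fderivWithin_le (K := ∑ i, K i) hconv (fun z hz => (hder z hz).1) ?_
      (z₀ := φ x) ⟨Metric.mem_ball_self hr, mem_range_self _⟩ hz ?_
    · intro z hz v
      have hv : v = ∑ i, v i • toModel (w i) := by
        ext j
        simp [w, toModel, Pi.single_apply]
      conv_lhs => rw [hv]
      rw [map_sum, Finset.sum_mul, Finset.sum_mul]
      refine norm_sum_le_of_le _ fun i _ => ?_
      rw [map_smul, norm_smul]
      have h1 := (hder z hz).2 i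
      have h2 : ‖v i‖ ≤ ‖v‖ := PiLp.norm_apply_le v i
      calc ‖v i‖ * _ ≤ ‖v‖ * (K i * ‖(Ψ.toFun a ∘ φ.symm) z‖) :=
            mul_le_mul h2 h1 (norm_nonneg _) (norm_nonneg _)
        _ = _ := by ring
    · rw [Function.comp_apply, hφ, extChartAt_to_inv, h0]
  have hsn : φ ⁻¹' Metric.ball (φ x) r ∈ 𝓝 x :=
    (continuousAt_extChartAt (I := 𝓡∂ n) x).preimage_mem_nhds (Metric.ball_mem_nhds _ hr)
  filter_upwards [hsn, extChartAt_source_mem_nhds (I := 𝓡∂ n) x] with y hy hys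
  rw [← φ.left_inv hys]
  exact key _ ⟨hy, mem_range_self _⟩

lemma eq_zero_of_eq_zero (Ψ : SpinorField P C) {a b : ι} {x : M} (ha : x ∈ P.U a) (hb : x ∈ P.U b)
    (h : Ψ.toFun b x = 0) : Ψ.toFun a x = 0 := by
  rw [Ψ.compat a b x ⟨ha, hb⟩, h, map_zero]

/-- An imaginary Killing spinor on a connected manifold which is not identically zero has no
zeros. -/
lemma IsImaginaryKilling.toFun_ne_zero [ConnectedSpace M] (hD : IsLeviCivita D)
    {Ψ : SpinorField P C} {ε : ℝ} (hK : Ψ.IsImaginaryKilling D ε)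
    (hΨ : ∃ a, ∃ x ∈ P.U a, Ψ.toFun a x ≠ 0) {a : ι} {x : M} (hx : x ∈ P.U a) :
    Ψ.toFun a x ≠ 0 := by
  intro h0
  -- Vanishing does not depend on the frame, since transition functions act linearly; this is what
  -- makes `Z` closed.
  set Z : Set M := {x | ∃ a, x ∈ P.U a ∧ Ψ.toFun a x = 0} with hZ
  have hopen : IsOpen Z := by
    refine isOpen_iff_mem_nhds.2 fun y ⟨b, hb, hyb⟩ => ?_
    filter_upwards [hK.eventually_eq_zero hD hb hyb, (P.isOpen_U b).mem_nhds hb] with z hz hzb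
    exact ⟨b, hzb, hz⟩
  have hclosed : IsClosed Z := by
    rw [← isOpen_compl_iff]
    refine isOpen_iff_mem_nhds.2 fun y hy => ?_
    obtain ⟨b, hb⟩ := P.cover y
    have hyb : Ψ.toFun b y ≠ 0 := fun h => hy ⟨b, hb, h⟩
    filter_upwards [(Ψ.contMDiffAt_toFun hb).continuousAt.eventually_ne hyb,
      (P.isOpen_U b).mem_nhds hb] with z hz hzb
    rintro ⟨d, hd, hzd⟩
    exact hz (Ψ.eq_zero_of_eq_zero hzb hd hzd)
  rcases isClopen_iff.1 ⟨hclosed, hopen⟩ with h | h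
  · exact (h ▸ (⟨a, hx, h0⟩ : x ∈ Z) : x ∈ (∅ : Set M))
  · obtain ⟨b, y, hb, hy⟩ := hΨ
    obtain ⟨d, hd, hyd⟩ : y ∈ Z := h ▸ mem_univ y
    exact hy (Ψ.eq_zero_of_eq_zero hb hd hyd)

end SpinorField

end NonVanishing
end KillingSpinor
end

noncomputable section
namespace KillingSpinor

/-! ### Boundary, tangent directions and the normal field -/

section Boundary

open Filter Topology

set_option linter.unusedSectionVars false

variable {n : ℕ} [NeZero n] {M : Type*} [TopologicalSpace M]
  [ChartedSpace (EuclideanHalfSpace n) M] [IsManifold (𝓡∂ n) ∞ M]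

lemma extChartAt_apply_zero_nonneg (p q : M) : 0 ≤ extChartAt (𝓡∂ n) p q 0 := by
  have : extChartAt (𝓡∂ n) p q ∈ range (𝓡∂ n) := mem_range_self _
  rwa [range_modelWithCornersEuclideanHalfSpace] at this

lemma mem_boundary_iff {p q : M} (hq : q ∈ (chartAt (EuclideanHalfSpace n) p).source) :
    q ∈ (𝓡∂ n).boundary M ↔ extChartAt (𝓡∂ n) p q 0 = 0 := by
  have h1 : (𝓡∂ n).IsInteriorPoint q ↔ extChartAt (𝓡∂ n) p q ∈ interior (range (𝓡∂ n)) := by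
    have h := (𝓡∂ n).isInteriorPoint_iff_of_mem_atlas (n := ∞) (by simp)
      (chart_mem_atlas (EuclideanHalfSpace n) p) hq
    exact h.trans ⟨fun h' => (chartAt (EuclideanHalfSpace n) p).interior_extend_target_subset_interior_range h',
      fun h' => (chartAt (EuclideanHalfSpace n) p).mem_interior_extend_target
        ((chartAt (EuclideanHalfSpace n) p).map_source hq) h'⟩
  rw [interior_range_modelWithCornersEuclideanHalfSpace] at h1
  have h2 : q ∈ (𝓡∂ n).boundary M ↔ ¬ (𝓡∂ n).IsInteriorPoint q := by
    rw [(𝓡∂ n).isInteriorPoint_iff_not_isBoundaryPoint q, not_not]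
    rfl
  rw [h2, h1]
  exact ⟨fun h => le_antisymm (not_lt.1 h) (extChartAt_apply_zero_nonneg p q),
    fun h h' => (ne_of_gt h') h⟩

lemma dBdFun_apply {p q : M} (hq : q ∈ (chartAt (EuclideanHalfSpace n) p).source) (X : T n q) :
    dBdFun p q X = (EuclideanSpace.proj 0 : EuclideanSpace ℝ (Fin n) →L[ℝ] ℝ)
      (mfderiv (𝓡∂ n) 𝓘(ℝ, EuclideanSpace ℝ (Fin n)) (extChartAt (𝓡∂ n) p) q X) :=
  mvfderiv_clm (EuclideanSpace.proj 0 : EuclideanSpace ℝ (Fin n) →L[ℝ] ℝ)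
    (mdifferentiableAt_extChartAt hq) X

lemma dBdFun_self (p : M) (X : T n p) : dBdFun p p X = (toModel X : EuclideanSpace ℝ (Fin n)) 0 := by
  rw [dBdFun_apply (mem_chart_source _ p), mfderiv_extChartAt_self]
  rfl

lemma dBdFun_ne_zero {p q : M} (hq : q ∈ (chartAt (EuclideanHalfSpace n) p).source) :
    dBdFun (n := n) p q ≠ 0 := by
  intro h
  obtain ⟨e, he⟩ := isInvertible_mfderiv_extChartAt (I := 𝓡∂ n) (x := p) (y := q)
    (by rwa [extChartAt_source])
  have h1 := dBdFun_apply hq (e.symm (EuclideanSpace.single 0 1 : EuclideanSpace ℝ (Fin n)))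
  rw [h, ← he] at h1
  have h2 := e.apply_symm_apply (EuclideanSpace.single 0 1 : EuclideanSpace ℝ (Fin n))
  have h3 : (0 : ℝ) = (EuclideanSpace.single 0 1 : EuclideanSpace ℝ (Fin n)) 0 :=
    h1.trans (congrArg (fun v : EuclideanSpace ℝ (Fin n) => v 0) h2)
  simp at h3

lemma contMDiffAt_bdFun (p : M) : ContMDiffAt (𝓡∂ n) 𝓘(ℝ, ℝ) ∞ (bdFun (n := n) p) p :=
  (EuclideanSpace.proj 0 : EuclideanSpace ℝ (Fin n) →L[ℝ] ℝ).contMDiff.contMDiffAt.comp p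
    contMDiffAt_extChartAt

lemma mdifferentiableAt_bdFun {p q : M} (hq : q ∈ (chartAt (EuclideanHalfSpace n) p).source) :
    MDifferentiableAt (𝓡∂ n) 𝓘(ℝ, ℝ) (bdFun (n := n) p) q :=
  mdifferentiableAt_clm (EuclideanSpace.proj 0 : EuclideanSpace ℝ (Fin n) →L[ℝ] ℝ)
    (mdifferentiableAt_extChartAt hq)

/-- Read in the chart at `q`, the nonnegative function `bdFun p` has its minimum `0` over the
half-space at `q`, so its derivative is nonnegative in directions pointing into the half-space. -/
lemma dBdFun_nonneg {p q : M} (hq : q ∈ (chartAt (EuclideanHalfSpace n) p).source)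
    (hb : q ∈ (𝓡∂ n).boundary M) {X : T n q} (hX : 0 ≤ dBdFun q q X) : 0 ≤ dBdFun p q X := by
  have hb' := (mem_boundary_iff hq).1 hb
  refine IsLocalMinOn.hasFDerivWithinAt_nonneg (s := range (𝓡∂ n)) (a := extChartAt (𝓡∂ n) q q)
    (f := bdFun p ∘ (extChartAt (𝓡∂ n) q).symm) (y := (toModel X : EuclideanSpace ℝ (Fin n))) ?_
    (hasFDerivWithinAt_mvfderiv (mdifferentiableAt_bdFun hq)) ?_
  · refine Filter.Eventually.of_forall fun z => ?_
    rw [Function.comp_apply, extChartAt_to_inv, bdFun, hb']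
    exact extChartAt_apply_zero_nonneg _ _
  · refine mem_posTangentConeAt_of_segment_subset
      ((𝓡∂ n).convex_range.segment_subset (mem_range_self _) ?_)
    rw [range_modelWithCornersEuclideanHalfSpace]
    rw [dBdFun_self] at hX
    exact add_nonneg (extChartAt_apply_zero_nonneg q q) hX

/-- At a boundary point, the differentials of the boundary defining functions of two charts are
positive multiples of each other. -/
lemma exists_dBdFun_eq_smul {p q : M} (hq : q ∈ (chartAt (EuclideanHalfSpace n) p).source)
    (hb : q ∈ (𝓡∂ n).boundary M) : ∃ κ : ℝ, 0 < κ ∧ dBdFun p q = κ • dBdFun (n := n) q q := by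
  let e₀ : T n q := (EuclideanSpace.single 0 1 : EuclideanSpace ℝ (Fin n))
  have he : dBdFun q q e₀ = 1 := by
    rw [dBdFun_self]
    exact (by simp : (EuclideanSpace.single 0 1 : EuclideanSpace ℝ (Fin n)) 0 = 1)
  -- Nonnegativity applies to both `X` and `-X`.
  have hker : ∀ X : T n q, dBdFun q q X = 0 → dBdFun p q X = 0 := by
    intro X hX
    have h1 := dBdFun_nonneg hq hb (X := X) hX.ge
    have h2 := dBdFun_nonneg hq hb (X := -X) (by rw [map_neg, hX, neg_zero])
    rw [map_neg] at h2
    linarith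
  have heq : dBdFun p q = dBdFun p q e₀ • dBdFun (n := n) q q := by
    ext X
    have h := hker (X - dBdFun q q X • e₀) (by
      rw [map_sub, map_smul, he, smul_eq_mul, mul_one, sub_self])
    rw [map_sub, map_smul, sub_eq_zero] at h
    rw [h, smul_apply, smul_eq_mul, smul_eq_mul, mul_comm]
  refine ⟨dBdFun p q e₀, lt_of_le_of_ne (dBdFun_nonneg hq hb (by rw [he]; exact zero_le_one)) ?_,
    heq⟩
  intro h0
  rw [← h0, zero_smul] at heq
  exact dBdFun_ne_zero hq heq

/-- A function which vanishes along the boundary has zero derivative in the directions tangent to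
the boundary. -/
lemma mvfderiv_eq_zero_of_mem_bdTangent {V : Type*} [NormedAddCommGroup V] [NormedSpace ℝ V]
    {f : M → V} {p : M} (hf : MDifferentiableAt (𝓡∂ n) 𝓘(ℝ, V) f p)
    (hp : p ∈ (𝓡∂ n).boundary M) (h : ∀ᶠ y in 𝓝 p, y ∈ (𝓡∂ n).boundary M → f y = 0)
    {X : T n p} (hX : X ∈ bdTangent (n := n) p) : mvfderiv (𝓡∂ n) f p X = 0 := by
  set φ := extChartAt (𝓡∂ n) p with hφ
  let w : EuclideanSpace ℝ (Fin n) := toModel X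
  have hw : w 0 = 0 := (dBdFun_self p X).symm.trans hX
  have hp0 : φ p 0 = 0 := (mem_boundary_iff (mem_chart_source _ p)).1 hp
  have hline0 : ∀ t : ℝ, (φ p + t • w) 0 = 0 := fun t => by
    rw [PiLp.add_apply, PiLp.smul_apply, hp0, hw, smul_zero, add_zero]
  -- The straight line in direction `w` stays in the hyperplane `x 0 = 0`, so near `t = 0` it
  -- parametrizes boundary points of `M`, where `f` vanishes.
  have hline : ∀ t : ℝ, φ p + t • w ∈ range (𝓡∂ n) := fun t => by
    rw [range_modelWithCornersEuclideanHalfSpace]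
    exact (hline0 t).ge
  have hder : HasDerivAt (fun t : ℝ => φ p + t • w) w 0 := by
    simpa using ((hasDerivAt_id (0 : ℝ)).smul_const w).const_add (φ p)
  have hF := hasFDerivWithinAt_mvfderiv hf
  rw [← hφ] at hF
  have h0 : φ p + (0 : ℝ) • w = φ p := by rw [zero_smul, add_zero]
  have hF' := HasFDerivWithinAt.comp_hasDerivWithinAt (0 : ℝ) (h0.symm ▸ hF)
    hder.hasDerivWithinAt (s := univ) (fun t _ => hline t)
  rw [hasDerivWithinAt_univ] at hF'
  have hev : (f ∘ φ.symm) ∘ (fun t : ℝ => φ p + t • w) =ᶠ[𝓝 0] fun _ => 0 := by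
    have hcont : Tendsto (fun t : ℝ => φ p + t • w) (𝓝 0) (𝓝[range (𝓡∂ n)] (φ p)) := by
      refine tendsto_nhdsWithin_iff.2 ⟨?_, Filter.Eventually.of_forall hline⟩
      have := hder.continuousAt
      rwa [ContinuousAt, h0] at this
    have hc : Tendsto φ.symm (𝓝[range (𝓡∂ n)] (φ p)) (𝓝 p) := by
      have := (continuousAt_extChartAt_symm (I := 𝓡∂ n) p)
      rw [ContinuousAt, extChartAt_to_inv] at this
      exact this.mono_left nhdsWithin_le_nhds
    filter_upwards [hcont.eventually (extChartAt_target_mem_nhdsWithin (I := 𝓡∂ n) p),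
      (hc.comp hcont).eventually h] with t ht1 ht2
    refine ht2 ((mem_boundary_iff (p := p) ?_).2 ?_)
    · rw [← extChartAt_source (𝓡∂ n)]
      exact φ.map_target ht1
    · have := φ.right_inv ht1
      exact (congrArg (fun v : EuclideanSpace ℝ (Fin n) => v 0) this).trans (hline0 t)
  exact (hF'.congr_of_eventuallyEq hev.symm).unique (hasDerivAt_const _ _)

lemma finrank_bdTangent (p : M) : (Module.finrank ℝ (bdTangent (n := n) p) : ℝ) = n - 1 := by
  have h := Module.Dual.finrank_ker_add_one_of_ne_zero (f := (dBdFun (n := n) p p).toLinearMap)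
    (fun h => dBdFun_ne_zero (mem_chart_source _ p) (ContinuousLinearMap.coe_injective h))
  have h2 : Module.finrank ℝ (T n p) = n := finrank_euclideanSpace_fin
  rw [h2] at h
  have h3 : ((Module.finrank ℝ (bdTangent (n := n) p) + 1 : ℕ) : ℝ) = n := congrArg Nat.cast h
  push_cast at h3
  linarith

variable [RiemannianBundle (fun x : M => TangentSpace (𝓡∂ n) x)]

/-- The differentials of the two boundary functions differ by a positive factor, which normalization
removes. Hence the boundary condition at all boundary points near `p` involves the single
differentiable field `normalField p`. -/
lemma normalField_eq_inwardNormal {p q : M}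
    (hq : q ∈ (chartAt (EuclideanHalfSpace n) p).source) (hb : q ∈ (𝓡∂ n).boundary M) :
    normalField p q = inwardNormal (n := n) q := by
  obtain ⟨κ, hκ, h⟩ := exists_dBdFun_eq_smul hq hb
  simp only [inwardNormal, normalField, h, map_smul, norm_smul, smul_smul, mul_inv]
  rw [Real.norm_of_nonneg hκ.le, mul_right_comm, inv_mul_cancel₀ hκ.ne', one_mul]

lemma inner_inwardNormal_of_mem_bdTangent {p : M} {X : T n p} (hX : X ∈ bdTangent (n := n) p) :
    (inner ℝ X (inwardNormal p) : ℝ) = 0 := by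
  have : dBdFun p p X = 0 := hX
  rw [inwardNormal, normalField, real_inner_smul_right, real_inner_comm,
    InnerProductSpace.toDual_symm_apply, this, mul_zero]

variable [IsContMDiffRiemannianBundle (𝓡∂ n) ∞ (EuclideanSpace ℝ (Fin n))
      (fun x : M => TangentSpace (𝓡∂ n) x)]
  {ι : Type*} (P : SpinStructure ι n M)

include P in
-- The spin structure serves only as a source of a smooth orthonormal frame, in which the gradient
-- of `b` is `∑ db(e_i) e_i`.
lemma diffVectorFieldAt_normalField (p : M) : DiffVectorFieldAt (normalField (n := n) p) p := by
  obtain ⟨a, ha⟩ := P.cover p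
  let g : Π y : M, T n y := fun y => (InnerProductSpace.toDual ℝ (T n y)).symm (dBdFun p y)
  have hg : SmoothVectorFieldAt g p := by
    have h1 : SmoothVectorFieldAt
        (fun y => ∑ i, ((fun y => dBdFun p y (P.e a i y)) • P.e a i) y) p :=
      ContMDiffAt.sum_section (fun i _ => ContMDiffAt.smul_section
        (contMDiffAt_mvfderiv_apply (contMDiffAt_bdFun p) (P.contMDiffAt_e ha i))
        (P.contMDiffAt_e ha i))
    refine h1.congr_of_eventuallyEq ?_
    filter_upwards [(P.isOpen_U a).mem_nhds ha] with y hy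
    congr 1
    rw [← P.sum_coords a hy (g y)]
    refine Finset.sum_congr rfl fun i _ => ?_
    rw [real_inner_comm, InnerProductSpace.toDual_symm_apply]
    rfl
  have hinner : ContMDiffAt (𝓡∂ n) 𝓘(ℝ, ℝ) ∞ (fun y => (inner ℝ (g y) (g y) : ℝ)) p :=
    hg.inner_bundle hg
  have hg0 : g p ≠ 0 := by
    intro h
    exact dBdFun_ne_zero (mem_chart_source _ p)
      ((InnerProductSpace.toDual ℝ (T n p)).symm.map_eq_zero_iff.1 h)
  have hpos : (inner ℝ (g p) (g p) : ℝ) ≠ 0 := inner_self_ne_zero.2 hg0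
  -- `‖g‖⁻¹` is treated as `(√⟨g, g⟩)⁻¹`, smooth because `g p ≠ 0`.
  have hs : ContDiffAt ℝ ∞ (fun t : ℝ => (Real.sqrt t)⁻¹) (inner ℝ (g p) (g p) : ℝ) :=
    (Real.contDiffAt_sqrt hpos).inv (Real.sqrt_ne_zero'.2 (real_inner_self_pos.2 hg0))
  have hnorm := (hs.comp_contMDiffAt (f := fun y => (inner ℝ (g y) (g y) : ℝ)) hinner).smul_section hg
  refine (hnorm.mdifferentiableAt (by simp)).congr_of_eventuallyEq
    (Filter.Eventually.of_forall fun y => ?_)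
  change TotalSpace.mk' _ y _ = TotalSpace.mk' _ y _
  congr 1

end Boundary
end KillingSpinor
end

noncomputable section
namespace KillingSpinor

/-! ### The θ-boundary condition and umbilicity -/

section BoundaryCondition

open Filter Topology

set_option linter.unusedSectionVars false

lemma exp_I_smul_involution {S : Type*} [NormedAddCommGroup S] [InnerProductSpace ℂ S]
    [FiniteDimensional ℂ S] {Q : S →L[ℂ] S} (hQ : Q * Q = 1) (θ : ℝ) :
    NormedSpace.exp ((Complex.I * (θ : ℂ)) • Q) =
      (Real.cos θ : ℂ) • (1 : S →L[ℂ] S) + (Complex.I * (Real.sin θ : ℂ)) • Q := by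
  let _ : Algebra ℚ (S →L[ℂ] S) := Algebra.compHom _ (algebraMap ℚ ℂ)
  -- Functional calculus of the involution: `(z₁, z₂)` acts by `z₁` on the `+1` and by `z₂` on the
  -- `-1` eigenspace of `Q`. Being a continuous ring homomorphism, `f` commutes with `exp`.
  let f : ℂ × ℂ →+* (S →L[ℂ] S) :=
    { toFun := fun z => ((z.1 + z.2) / 2) • 1 + ((z.1 - z.2) / 2) • Q
      map_one' := by simp
      map_zero' := by simp
      map_add' := fun z w => by
        simp only [Prod.fst_add, Prod.snd_add]
        module
      map_mul' := fun z w => by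
        simp only [Prod.fst_mul, Prod.snd_mul, add_mul, mul_add, smul_mul_assoc, mul_smul_comm,
          one_mul, mul_one, hQ]
        module }
  have hf : Continuous f := by
    change Continuous fun z : ℂ × ℂ => ((z.1 + z.2) / 2) • (1 : S →L[ℂ] S) + ((z.1 - z.2) / 2) • Q
    fun_prop
  have h := NormedSpace.map_exp f hf (Complex.I * (θ : ℂ), -(Complex.I * (θ : ℂ)))
  have h1 : f (Complex.I * (θ : ℂ), -(Complex.I * (θ : ℂ))) = (Complex.I * (θ : ℂ)) • Q := by
    change ((Complex.I * (θ : ℂ) + -(Complex.I * (θ : ℂ))) / 2) • (1 : S →L[ℂ] S) +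
      ((Complex.I * (θ : ℂ) - -(Complex.I * (θ : ℂ))) / 2) • Q = _
    module
  rw [h1] at h
  rw [← h]
  change (((NormedSpace.exp _ : ℂ × ℂ).1 + (NormedSpace.exp _ : ℂ × ℂ).2) / 2) • (1 : S →L[ℂ] S) +
    (((NormedSpace.exp _ : ℂ × ℂ).1 - (NormedSpace.exp _ : ℂ × ℂ).2) / 2) • Q = _
  rw [Prod.fst_exp, Prod.snd_exp, ← Complex.exp_eq_exp_ℂ]
  have e1 : Complex.exp (Complex.I * θ) = Complex.cos θ + Complex.sin θ * Complex.I := by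
    rw [mul_comm, Complex.exp_mul_I]
  have e2 : Complex.exp (-(Complex.I * θ)) = Complex.cos θ - Complex.sin θ * Complex.I := by
    rw [← mul_neg, mul_comm, Complex.exp_mul_I, Complex.cos_neg, Complex.sin_neg]
    ring
  rw [e1, e2, Complex.ofReal_cos, Complex.ofReal_sin]
  module

/-- The differentiated boundary condition determines the Clifford action of the shape operator:
here `N`, `X`, `W` are Clifford multiplications by the normal, a tangent vector and the derivative
of the normal, `G` is the spin connection form, and `E = exp(iθQ)`. -/
lemma shape_of_boundary_condition {S : Type*} [NormedAddCommGroup S] [InnerProductSpace ℂ S]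
    {Q E E' N X W G : S →L[ℂ] S} {ε θ : ℝ} (hε : ε * ε = 1) (hQ : Q * Q = 1)
    (hE : E = (Real.cos θ : ℂ) • (1 : S →L[ℂ] S) + (Complex.I * (Real.sin θ : ℂ)) • Q)
    (hE' : E' = (Real.cos θ : ℂ) • (1 : S →L[ℂ] S) - (Complex.I * (Real.sin θ : ℂ)) • Q)
    (hX : Q * X = -(X * Q)) (hG : Q * G = G * Q) (hNX : N * X = -(X * N)) {ψ : S}
    (h0 : (E * Q * N - (ε : ℂ) • 1) ψ = 0)
    (h1 : (E * Q * (W - (G * N - N * G)) + E * Q * N * (-G - ((ε : ℂ) * (Complex.I / 2)) • X) -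
      (ε : ℂ) • (-G - ((ε : ℂ) * (Complex.I / 2)) • X)) ψ = 0) :
    (W + (Real.sin θ : ℂ) • X) ψ = 0 := by
  have hcs : (Real.cos θ : ℂ) * Real.cos θ + (Real.sin θ : ℂ) * Real.sin θ = 1 := by
    have := Real.cos_sq_add_sin_sq θ
    rw [← Complex.ofReal_mul, ← Complex.ofReal_mul, ← Complex.ofReal_add, ← sq, ← sq, this,
      Complex.ofReal_one]
  -- The operator `E'` is `exp(-iθQ) = E⁻¹`; an operator anticommuting with `Q` exchanges `E` and
  -- `E'` when moved across, and one commuting with `Q` passes through both.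
  have hε' : (ε : ℂ) * ε = 1 := by exact_mod_cast hε
  have hE'E : E' * E = 1 := by
    simp only [hE, hE', sub_mul, mul_add, smul_mul_assoc, mul_smul_comm, one_mul, mul_one, hQ]
    have : (1 : S →L[ℂ] S) = ((Real.cos θ : ℂ) * Real.cos θ + (Real.sin θ : ℂ) * Real.sin θ) • 1 := by
      rw [hcs, one_smul]
    conv_rhs => rw [this]
    have h2 : (Complex.I * (Real.sin θ : ℂ)) * (Complex.I * (Real.sin θ : ℂ)) =
      -((Real.sin θ : ℂ) * Real.sin θ) := by
      linear_combination ((Real.sin θ : ℂ) * Real.sin θ) * Complex.I_mul_I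
    simp only [smul_sub, smul_smul, h2]
    module
  have hEX : E * X = X * E' := by
    simp only [hE, hE', add_mul, mul_sub, smul_mul_assoc, mul_smul_comm, one_mul, mul_one, hX]
    module
  have hE'X : E' * X = X * E := by
    simp only [hE, hE', sub_mul, mul_add, smul_mul_assoc, mul_smul_comm, one_mul, mul_one, hX]
    module
  have hEG : E * G = G * E := by
    simp only [hE, add_mul, mul_add, smul_mul_assoc, mul_smul_comm, one_mul, mul_one, hG]
  set m : ℂ := (ε : ℂ) * (Complex.I / 2) with hm
  have hεm : (ε : ℂ) * m = Complex.I / 2 := by rw [hm, ← mul_assoc, hε', one_mul]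
  have hEE' : E * E' = 1 := by
    have : E * E' = E' * E := by
      simp only [hE, hE', add_mul, mul_add, sub_mul, mul_sub, smul_mul_assoc, mul_smul_comm,
        one_mul, mul_one]
      module
    rw [this, hE'E]
  have hdiff : Q * (E' - E) = (-2 * (Complex.I * (Real.sin θ : ℂ))) • (1 : S →L[ℂ] S) := by
    have : E' - E = (-2 * (Complex.I * (Real.sin θ : ℂ))) • Q := by
      rw [hE, hE']
      module
    rw [this, mul_smul_comm, hQ]
  -- The connection form survives only as a left factor of `E Q N - ε`, which annihilates `ψ`.
  have s1 : E * Q * (W - (G * N - N * G)) + E * Q * N * (-G - m • X) - (ε : ℂ) • (-G - m • X) =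
      E * Q * W - m • (X * E' * Q * N) + (Complex.I / 2) • X - G * (E * Q * N - (ε : ℂ) • 1) := by
    have e1 : E * Q * N * X = X * E' * Q * N := by
      rw [mul_assoc (E * Q), hNX, mul_neg, ← mul_assoc, mul_assoc E, hX, mul_neg, neg_mul, neg_neg,
        ← mul_assoc, hEX]
    have e2 : E * Q * (G * N) = G * (E * Q * N) := by
      rw [← mul_assoc, mul_assoc E, hG, ← mul_assoc, hEG]
      simp only [mul_assoc]
    simp only [mul_sub, mul_neg, mul_smul_comm, e1, e2, smul_sub, smul_neg, smul_smul, hεm,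
      ← mul_assoc, mul_one]
    abel
  -- `Q E'` inverts `E Q`. The added multiple of `E Q N - ε` replaces `m X E' Q N` by `(i/2) X E'²`,
  -- after which `Q(E' - E) = -2i sin θ` produces the coefficient `sin θ`.
  have s2 : W + (Real.sin θ : ℂ) • X = Q * E' * ((E * Q * W - m • (X * E' * Q * N) +
      (Complex.I / 2) • X) + m • (X * (E' * E')) * (E * Q * N - (ε : ℂ) • 1)) := by
    have e1 : (X * (E' * E')) * (E * Q * N) = X * E' * Q * N := by
      rw [mul_assoc X, mul_assoc E', ← mul_assoc E' (E * Q) N, ← mul_assoc E' E Q, hE'E, one_mul]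
      simp only [mul_assoc]
    have e2 : Q * E' * (E * Q * W) = W := by
      rw [mul_assoc, mul_assoc E, ← mul_assoc E', hE'E, one_mul, ← mul_assoc, hQ, one_mul]
    have e3 : Q * E' * X = -(X * (Q * E)) := by
      rw [mul_assoc, hE'X, ← mul_assoc, hX, neg_mul, mul_assoc]
    have e4 : Q * E' * (X * (E' * E')) = -(X * (Q * E')) := by
      rw [← mul_assoc, e3, neg_mul, mul_assoc X, mul_assoc Q, ← mul_assoc E E', hEE', one_mul]
    have e5 : X * (Q * E') = X * (Q * E) + (-2 * (Complex.I * (Real.sin θ : ℂ))) • X := by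
      have := congrArg (X * ·) hdiff
      simp only [mul_sub, mul_smul_comm, mul_one] at this
      rw [← this]
      abel
    simp only [smul_mul_assoc, mul_sub, mul_add, mul_smul_comm, mul_one, e1, e2, e3, e4, e5,
      smul_smul, hεm]
    have h2 : Complex.I / 2 * (-2 * (Complex.I * (Real.sin θ : ℂ))) = Real.sin θ := by
      linear_combination (-(Real.sin θ : ℂ)) * Complex.I_mul_I
    simp only [smul_neg, smul_add, smul_smul, h2]
    module
  rw [s1] at h1
  have h2 : (E * Q * W - m • (X * E' * Q * N) + (Complex.I / 2) • X) ψ = 0 := by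
    rw [sub_apply] at h1
    change _ - G ((E * Q * N - (ε : ℂ) • 1) ψ) = 0 at h1
    rwa [h0, map_zero, sub_zero] at h1
  rw [s2]
  change (Q * E') ((E * Q * W - m • (X * E' * Q * N) + (Complex.I / 2) • X) ψ +
    (m • (X * (E' * E'))) ((E * Q * N - (ε : ℂ) • 1) ψ)) = 0
  rw [h2, h0, map_zero, add_zero, map_zero]

variable {n : ℕ} [NeZero n] {M : Type*} [TopologicalSpace M]
  [ChartedSpace (EuclideanHalfSpace n) M] [IsManifold (𝓡∂ n) ∞ M]
  [RiemannianBundle (fun x : M => TangentSpace (𝓡∂ n) x)]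
  [IsContMDiffRiemannianBundle (𝓡∂ n) ∞ (EuclideanSpace ℝ (Fin n))
      (fun x : M => TangentSpace (𝓡∂ n) x)]
  {D : Connection n M} [T2Space M]
  {S : Type*} [NormedAddCommGroup S] [InnerProductSpace ℂ S] [FiniteDimensional ℂ S]
  {ι : Type*} {P : SpinStructure ι n M} {C : CliffordModule n S}

/-- Two sign changes cancel. Consequently `Q`, and with it `exp(iθQ)`, is parallel for the spin
connection. -/
lemma CliffordModule.IsChirality.mul_bivector {Q : S →L[ℂ] S} (hQ : C.IsChirality Q)
    (r : Fin n → Fin n → ℝ) : Q * bivector C.γ r = bivector C.γ r * Q := by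
  have h : ∀ i j, Q * (C.γ i * C.γ j) = C.γ i * C.γ j * Q := by
    intro i j
    rw [← mul_assoc, CliffordModule.γ, hQ.anticomm, neg_mul, mul_assoc, CliffordModule.γ,
      hQ.anticomm, mul_neg, neg_neg, ← mul_assoc]
  simp only [bivector, mul_smul_comm, smul_mul_assoc, Finset.mul_sum, Finset.sum_mul, h]

/-- A nowhere vanishing imaginary Killing spinor with the `θ`-boundary condition forces the
boundary to be totally umbilical. -/
lemma SpinorField.IsImaginaryKilling.shapeOperator_eq (hD : IsLeviCivita D) {Ψ : SpinorField P C}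
    {ε θ : ℝ} (hε : ε * ε = 1) (hK : Ψ.IsImaginaryKilling D ε) {Q : S →L[ℂ] S}
    (hQ : C.IsChirality Q) (hB : Ψ.ThetaBoundary Q θ ε) {a : ι} {p : M} (ha : p ∈ P.U a)
    (hp : p ∈ (𝓡∂ n).boundary M) (h0 : Ψ.toFun a p ≠ 0) {X : T n p}
    (hX : X ∈ bdTangent (n := n) p) : shapeOperator D p X = Real.sin θ • X := by
  set E : S →L[ℂ] S := NormedSpace.exp ((Complex.I * (θ : ℂ)) • Q) with hE
  have hN := diffVectorFieldAt_normalField P p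
  have hcN := P.mdifferentiableAt_cField C ha hN
  have hΨ := (Ψ.contMDiffAt_toFun ha).mdifferentiableAt (by simp)
  have hL := mdifferentiableAt_clm (opMul S (E * Q)) hcN
  have hc : MDifferentiableAt (𝓡∂ n) 𝓘(ℝ, S →L[ℂ] S)
    (fun _ : M => (ε : ℂ) • (1 : S →L[ℂ] S)) p := mdifferentiableAt_const
  have hF : MDifferentiableAt (𝓡∂ n) 𝓘(ℝ, S →L[ℂ] S)
      (fun y => opMul S (E * Q) (P.cField C a (normalField p) y) - (ε : ℂ) • (1 : S →L[ℂ] S)) p :=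
    hL.sub hc
  have hdF : mvfderiv (𝓡∂ n) (fun y => opMul S (E * Q) (P.cField C a (normalField p) y) -
      (ε : ℂ) • (1 : S →L[ℂ] S)) p X =
      E * Q * mvfderiv (𝓡∂ n) (P.cField C a (normalField p)) p X := by
    rw [mvfderiv_fun_sub hL hc, mvfderiv_const, sub_zero, mvfderiv_clm _ hcN]
    rfl
  have hG := mvfderiv_op_apply hF hΨ X
  -- `(E Q c(ν) - ε)Ψ`, with `ν` extended by `normalField p`, vanishes only along the boundary, so
  -- only its tangential derivatives are known to vanish.
  have hvan := mvfderiv_eq_zero_of_mem_bdTangent hG.1 hp (by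
    filter_upwards [(P.isOpen_U a).mem_nhds ha,
      (chartAt (EuclideanHalfSpace n) p).open_source.mem_nhds (mem_chart_source _ p)]
      with y hy hyp hyb
    have h := hB a y hy hyb
    rw [← normalField_eq_inwardNormal hyp hyb] at h
    exact sub_eq_zero.2 h) hX
  rw [hG.2, hdF, P.mvfderiv_cField C hD ha hN, hK.mvfderiv_eq ha] at hvan
  have h1 := hB a p ha hp
  have hXN : C.c (P.coords a p (inwardNormal p)) * C.c (P.coords a p X) =
      -(C.c (P.coords a p X) * C.c (P.coords a p (inwardNormal p))) := by
    refine C.c_anticomm _ _ ?_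
    rw [← inner_inwardNormal_of_mem_bdTangent hX, P.inner_eq_sum a ha]
    refine Finset.sum_congr rfl fun i _ => ?_
    rw [P.coords_apply, P.coords_apply, ← real_inner_comm X]
    rfl
  have key := shape_of_boundary_condition (N := C.c (P.coords a p (inwardNormal p)))
    (W := C.c (P.coords a p (D (normalField p) p X))) (G := P.spinForm C D a p X) hε hQ.involution
    (exp_I_smul_involution hQ.involution θ) rfl (hQ.anticomm (P.coords a p X))
    (hQ.mul_bivector _) hXN (ψ := Ψ.toFun a p) (sub_eq_zero.2 h1) (by
      rw [killingForm] at hvan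
      rw [add_sub_assoc]
      exact hvan)
  have hsum : C.c (P.coords a p (D (normalField p) p X + Real.sin θ • X)) (Ψ.toFun a p) = 0 := by
    rw [P.coords_add, P.coords_smul, C.c_add, C.c_smul, ← key, Complex.coe_smul]
  have := P.coords_injective a ha (C.eq_zero_of_c_apply_eq_zero h0 hsum)
  rw [shapeOperator, eq_neg_of_add_eq_zero_left this, neg_neg]

lemma meanCurvature_of_umbilical {p : M} {τ : ℝ}
    (h : ∀ X ∈ bdTangent (n := n) p, shapeOperator D p X = τ • X) :
    meanCurvature D p = ((n : ℝ) - 1) * τ := by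
  rw [meanCurvature, ← finrank_bdTangent p]
  have : ∀ i, (inner ℝ (shapeOperator D p (stdOrthonormalBasis ℝ (bdTangent (n := n) p) i : T n p))
      (stdOrthonormalBasis ℝ (bdTangent (n := n) p) i : T n p) : ℝ) = τ := by
    intro i
    rw [h _ (stdOrthonormalBasis ℝ (bdTangent (n := n) p) i).2, real_inner_smul_left,
      ← Submodule.coe_inner, real_inner_self_eq_norm_sq, OrthonormalBasis.norm_eq_one]
    norm_num
  simp only [this, Finset.sum_const, Finset.card_univ, Fintype.card_fin, nsmul_eq_mul]

end BoundaryCondition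
end KillingSpinor
end
theorem proposition4p3 {n : ℕ} [NeZero n] {M : Type*} [TopologicalSpace M] [T2Space M]
    [SecondCountableTopology M] [ConnectedSpace M]
    [ChartedSpace (EuclideanHalfSpace n) M] [IsManifold (𝓡∂ n) ∞ M]
    [RiemannianBundle (fun x : M => TangentSpace (𝓡∂ n) x)]
    [IsContMDiffRiemannianBundle (𝓡∂ n) ∞ (EuclideanSpace ℝ (Fin n))
      (fun x : M => TangentSpace (𝓡∂ n) x)]
    (D : Connection n M) (hD : IsLeviCivita D)
    {ι : Type*} (P : SpinStructure ι n M)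
    {S : Type*} [NormedAddCommGroup S] [InnerProductSpace ℂ S] [FiniteDimensional ℂ S]
    (C : CliffordModule n S) (Q : S →L[ℂ] S) (hQ : C.IsChirality Q)
    (s θ : ℝ) (hθ : θ ∈ Set.Ioo (-(Real.pi / 2)) (Real.pi / 2))
    (hs : s / Real.sqrt (1 + s ^ 2) = Real.sin θ)
    (ε : ℝ) (hε : ε = 1 ∨ ε = -1)
    (Ψ : SpinorField P C) (hΨ : ∃ a, ∃ x ∈ P.U a, Ψ.toFun a x ≠ 0)
    (hK : Ψ.IsImaginaryKilling D ε) (hB : Ψ.ThetaBoundary Q θ ε) :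
    (∀ (x : M) (v w : T n x), ricci D x v w = -((n : ℝ) - 1) * inner ℝ v w) ∧
    (∀ p ∈ (𝓡∂ n).boundary M,
      (∀ X ∈ bdTangent (n := n) p, shapeOperator D p X = Real.sin θ • X) ∧
      meanCurvature D p = ((n : ℝ) - 1) * (s / Real.sqrt (1 + s ^ 2))) := by
  have hε' : ε * ε = 1 := by rcases hε with rfl | rfl <;> norm_num
  have hne : ∀ {a : ι} {x : M}, x ∈ P.U a → Ψ.toFun a x ≠ 0 := fun hx =>
    hK.toFun_ne_zero hD hΨ hx
  refine ⟨fun x v w => ?_, fun p hp => ?_⟩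
  · obtain ⟨a, ha⟩ := P.cover x
    exact hK.ricci_eq hD hε' ha (hne ha) v w
  · obtain ⟨a, ha⟩ := P.cover p
    have h : ∀ X ∈ bdTangent (n := n) p, shapeOperator D p X = Real.sin θ • X := fun X hX =>
      hK.shapeOperator_eq hD hε' hQ hB ha hp (hne ha) hX
    exact ⟨h, by rw [hs]; exact meanCurvature_of_umbilical h⟩
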